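/- \textbf{Proposition ($L^p$ stability estimate for regular Lagrangian flows).} Let $d\in\mathbb N$, $1<p<\infty$ and $T>0$. For a vector field $b:(0,T)\times\mathbb R^d\to\mathbb R^d$, a map $X:[0,T]\times\mathbb R^d\to\mathbb R^d$ is called a \emph{regular Lagrangian flow} of $b$ if (i) for a.e. $x\in\mathbb R^d$ the curve $t\mapsto X(t,x)$ is absolutely continuous on $[0,T]$, $X(0,x)=x$, and $\partial_tX(t,x)=b(t,X(t,x))$ for a.e. $t\in(0,T)$; (ii) there is a constant $L>0$ with $X(t,\cdot)_\#\mathscr L^d\le L\,\mathscr L^d$ for every $t\in[0,T]$, where $\mathscr L^d$ is the Lebesgue measure. Any such $L$ is called a \emph{compressibility constant} of $X$ (on $[0,T]$). Then there is a function $(t,r,M,\tilde M,L,\tilde L,D)\mapsto C_t(r,M,\tilde M,L,\tilde L,D)\in[0,\infty)$, depending on nothing else than $d,p,T$, with $$\lim_{t\to0^+}C_t(r,M,\tilde M,L,\tilde L,D)=0\quad\text{for all fixed } r,M,\tilde M,L,\tilde L,D,$$ such that the following holds. Let $b,\tilde b\in L^1(0,T;W^{1,p}(\mathbb R^d;\mathbb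 R^d))\cap L^\infty((0,T)\times\mathbb R^d;\mathbb R^d)$, let $X,\tilde X$ be regular Lagrangian flows of $b,\tilde b$ with compressibility constants $L,\tilde L$, let $r>0$ and put $R=r+T\|\tilde b\|_{L^\infty((0,T)\times\mathbb R^d)}$. Then for every $t\in[0,T]$ $$\|X(t,\cdot)-\tilde X(t,\cdot)\|_{L^p(B_r(0))}\le C_t\,\Big|\log\|b-\tilde b\|_{L^1(0,t;L^p(B_R(0)))}\Big|^{-1},$$ where $C_t=C_t\big(r,\|b\|_{L^\infty},\|\tilde b\|_{L^\infty},L,\tilde L,\|D_xb\|_{L^1(0,T;L^p(\mathbb R^d))}\big)$, with the conventions $|\log0|^{-1}=0$ and $|\log1|^{-1}=\infty$ (and $0\cdot\infty=0$). -/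

import Mathlib

open MeasureTheory Set Filter Topology
open scoped NNReal ENNReal ContDiff

noncomputable section

/-- The Euclidean space `ℝ^d`. -/
abbrev Rd (d : ℕ) : Type := EuclideanSpace ℝ (Fin d)

/-- `G` is the weak (distributional) gradient of the vector field `f` on `ℝ^d`: both are locally
integrable and `∫ φ ∂_v f = - ∫ (∂_v φ) f` for every test function `φ` and every direction `v`. -/
structure IsWeakGradient {d : ℕ} (f : Rd d → Rd d) (G : Rd d → Rd d →L[ℝ] Rd d) : Prop where
  locallyIntegrable : LocallyIntegrable f volume
  locallyIntegrable_grad : LocallyIntegrable G volume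
  integral_eq : ∀ φ : Rd d → ℝ, ContDiff ℝ ∞ φ → HasCompactSupport φ → ∀ v : Rd d,
    ∫ x, φ x • G x v = - ∫ x, (fderiv ℝ φ x v) • f x

/-- Lebesgue measure on the space-time cylinder `(0, T) × ℝ^d`. -/
def spaceTimeMeasure (d : ℕ) (T : ℝ) : Measure (ℝ × Rd d) :=
  (volume.restrict (Ioo 0 T)).prod volume

/-- The norm of `L^∞((0, T) × ℝ^d)` (essential supremum). -/
def supNorm {d : ℕ} (T : ℝ) (b : ℝ → Rd d → Rd d) : ℝ≥0∞ :=
  eLpNorm (Function.uncurry b) ⊤ (spaceTimeMeasure d T)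

/-- The norm `∫_0^t ‖f(s, ·)‖_{L^p(A)} ds` of `L^1(0, t; L^p(A))`. -/
def mixedNorm {d : ℕ} {F : Type*} [NormedAddCommGroup F] (t p : ℝ) (A : Set (Rd d))
    (f : ℝ → Rd d → F) : ℝ≥0∞ :=
  ∫⁻ s in Ioo 0 t, eLpNorm (f s) (ENNReal.ofReal p) (volume.restrict A)

/-- The vector field `b` is in `L^1(0, T; W^{1,p}(ℝ^d))`, with weak spatial gradient `Db`. -/
structure HasSobolevGradient {d : ℕ} (T p : ℝ) (b : ℝ → Rd d → Rd d)
    (Db : ℝ → Rd d → Rd d →L[ℝ] Rd d) : Prop where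
  measurable : AEStronglyMeasurable (Function.uncurry b) (spaceTimeMeasure d T)
  measurable_grad : AEStronglyMeasurable (Function.uncurry Db) (spaceTimeMeasure d T)
  isWeakGradient : ∀ᵐ t ∂volume.restrict (Ioo 0 T), IsWeakGradient (b t) (Db t)
  norm_lt_top : mixedNorm T p univ b < ⊤
  norm_grad_lt_top : mixedNorm T p univ Db < ⊤

/-- `L` is a compressibility constant of `X` on `[0, T]`: `X(t, ·)_# ℒ^d ≤ L ℒ^d` for every
`t ∈ [0, T]`. Measurability is required because `Measure.map` is zero otherwise. -/
def IsCompressibilityConstant {d : ℕ} (T : ℝ) (X : ℝ → Rd d → Rd d) (L : ℝ≥0) : Prop :=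
  0 < L ∧ ∀ t ∈ Icc 0 T, AEMeasurable (X t) volume ∧
    Measure.map (X t) volume ≤ (L : ℝ≥0∞) • (volume : Measure (Rd d))

/-- `X` is a regular Lagrangian flow on `[0, T]` of the vector field `b`. -/
structure IsRegularLagrangianFlow {d : ℕ} (T : ℝ) (b X : ℝ → Rd d → Rd d) : Prop where
  solution : ∀ᵐ x ∂(volume : Measure (Rd d)),
    X 0 x = x ∧ AbsolutelyContinuousOnInterval (fun t => X t x) 0 T ∧
      ∀ᵐ t ∂volume.restrict (Ioo 0 T), HasDerivAt (fun s => X s x) (b t (X t x)) t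
  compressible : ∃ L : ℝ≥0, IsCompressibilityConstant T X L

/-- `|log ε|⁻¹` in `[0, ∞]`, with `|log 0|⁻¹ = 0` and `|log 1|⁻¹ = ∞`. -/
def absLogInv (ε : ℝ≥0∞) : ℝ≥0∞ := (ENNReal.log ε).abs⁻¹

end

/-! The argument is of Crippa–De Lellis type. A Sobolev field is not Lipschitz, but it satisfies the
Lusin–Lipschitz inequality `|b(x) - b(y)| ≤ 4^d |x - y| (M|Db|(x) + M|Db|(y))` off a null set, where
`M` is the maximal operator, bounded on `L^p` for `p > 1`. This suggests measuring the distance of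
the flows logarithmically, by `½ log (1 + |X - X'|² / δ²)`. Its time derivative no longer sees the
factor `|x - y|`: it is at most `δ⁻¹ |b - b'|(X')` plus `4^d (M|Db|(X) + M|Db|(X'))`. Taking `L^p`
norms on `B_r`, Minkowski's integral inequality, compressibility and the maximal inequality bound
the norm of the gauge by `δ⁻¹ L'^{1/p} ε` plus a constant times `‖Db‖`, where `ε` is the mixed norm
of `b - b'`. For `ε ≤ δ` the bound does not depend on `δ`.

To return to `|X - X'|`, let `Z = t (‖b‖_∞ + ‖b'‖_∞)`, which bounds it. The elementary inequality
`|z| |log δ| ≤ 2 Z · gauge + 4 √Z` for `|z| ≤ Z` and `δ < 1` finishes the case `ε < 1`. Taking `δ =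
ε` settles `0 < ε < 1`, and letting `δ → 0` settles `ε = 0`. The decay of the constant as `t → 0`
comes from `Z` alone, not from the gradient norm, which is kept on all of `(0, T)`. If `ε ≥ 1`, then
`log ε ≤ ε`, and both `ε` and the distance of the flows are `O(t)`. -/

/-! ### Hardy–Littlewood maximal inequalities -/

/-- The centred Hardy–Littlewood maximal function, over closed balls of rational radius. -/
noncomputable def maximalFunction {d : ℕ} (h : Rd d → ℝ≥0∞) (x : Rd d) : ℝ≥0∞ :=
  ⨆ q : {q : ℚ // 0 < q}, (volume (Metric.closedBall x (q : ℝ)))⁻¹ *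
    ∫⁻ z in Metric.closedBall x (q : ℝ), h z

theorem volume_closedBall_pos {d : ℕ} (x : Rd d) {r : ℝ} (hr : 0 < r) :
    volume (Metric.closedBall x r) ≠ 0 :=
  (Metric.measure_closedBall_pos volume x hr).ne'

theorem volume_closedBall_ne_top {d : ℕ} (x : Rd d) (r : ℝ) :
    volume (Metric.closedBall x r) ≠ ⊤ :=
  measure_closedBall_lt_top.ne

theorem volume_closedBall_mul {d : ℕ} (x y : Rd d) {s r : ℝ} (hs : 0 ≤ s) (hr : 0 ≤ r) :
    volume (Metric.closedBall x (s * r)) =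
      ENNReal.ofReal s ^ d * volume (Metric.closedBall y r) := by
  rw [Measure.addHaar_closedBall_mul _ _ hs hr, ENNReal.ofReal_pow hs, finrank_euclideanSpace_fin,
    Measure.addHaar_closedBall_center _ y]

theorem measurable_maximalFunction {α : Type*} [MeasurableSpace α] {d : ℕ}
    {H : α → Rd d → ℝ≥0∞} (hH : Measurable (Function.uncurry H)) :
    Measurable fun z : α × Rd d => maximalFunction (H z.1) z.2 := by
  refine Measurable.iSup fun q => ?_
  have h1 : ∀ z : α × Rd d, volume (Metric.closedBall z.2 (q : ℝ)) =
      volume (Metric.closedBall (0 : Rd d) (q : ℝ)) := fun z =>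
    Measure.addHaar_closedBall_center _ _ _
  simp only [h1]
  refine Measurable.const_mul ?_ _
  have h2 : ∀ z : α × Rd d, ∫⁻ y in Metric.closedBall z.2 (q : ℝ), H z.1 y =
      ∫⁻ y, {w : (α × Rd d) × Rd d | dist w.2 w.1.2 ≤ q}.indicator
        (fun w => H w.1.1 w.2) (z, y) := by
    intro z
    rw [← lintegral_indicator Metric.isClosed_closedBall.measurableSet]
    rfl
  simp only [h2]
  refine Measurable.lintegral_prod_right' (f := {w : (α × Rd d) × Rd d |
    dist w.2 w.1.2 ≤ q}.indicator (fun w => H w.1.1 w.2)) ?_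
  refine Measurable.indicator (hH.comp (by fun_prop : Measurable
    fun w : (α × Rd d) × Rd d => (w.1.1, w.2))) ?_
  exact measurableSet_le (by fun_prop) measurable_const

theorem measurable_maximalFunction_right {d : ℕ} {h : Rd d → ℝ≥0∞} (hh : Measurable h) :
    Measurable (maximalFunction h) := by
  have h0 : Measurable (Function.uncurry fun _ : Unit => h) := hh.comp measurable_snd
  have h1 := measurable_maximalFunction h0
  have h2 : Measurable fun x : Rd d => ((), x) := measurable_prodMk_left
  simpa [Function.comp_def] using h1.comp h2

theorem maximalFunction_mono {d : ℕ} {h k : Rd d → ℝ≥0∞} (hk : ∀ x, h x ≤ k x) (x : Rd d) :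
    maximalFunction h x ≤ maximalFunction k x :=
  iSup_mono fun _ => by gcongr; exact hk _

theorem maximalFunction_add_const_le {d : ℕ} (h : Rd d → ℝ≥0∞) (c : ℝ≥0∞) (x : Rd d) :
    maximalFunction (fun z => h z + c) x ≤ maximalFunction h x + c := by
  refine iSup_le fun q => ?_
  have hq : (0 : ℝ) < (q : ℚ) := by exact_mod_cast q.2
  rw [lintegral_add_right _ measurable_const, mul_add, setLIntegral_const, mul_comm c, ← mul_assoc,
    ENNReal.inv_mul_cancel (volume_closedBall_pos x hq) (volume_closedBall_ne_top x _), one_mul]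
  gcongr
  exact le_iSup (fun q : {q : ℚ // 0 < q} => (volume (Metric.closedBall x (q : ℝ)))⁻¹ *
    ∫⁻ z in Metric.closedBall x (q : ℝ), h z) q

/-- Averages over balls of arbitrary radius are controlled by the maximal function. -/
theorem setLIntegral_closedBall_le_maximalFunction {d : ℕ} (h : Rd d → ℝ≥0∞) (x : Rd d) {r : ℝ}
    (hr : 0 < r) :
    ∫⁻ z in Metric.closedBall x r, h z ≤
      2 ^ d * volume (Metric.closedBall x r) * maximalFunction h x := by
  -- A rational radius in `(r, 2r)` costs at most the volume ratio `2 ^ d`.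
  obtain ⟨q, h1, h2⟩ := exists_rat_btwn (show r < 2 * r by linarith)
  have hq : (0 : ℝ) < q := hr.trans h1
  have hq' : 0 < q := by exact_mod_cast hq
  have h3 : (volume (Metric.closedBall x (q : ℝ)))⁻¹ * ∫⁻ z in Metric.closedBall x (q : ℝ), h z ≤
      maximalFunction h x :=
    le_iSup (fun q : {q : ℚ // 0 < q} => (volume (Metric.closedBall x (q : ℝ)))⁻¹ *
      ∫⁻ z in Metric.closedBall x (q : ℝ), h z) ⟨q, hq'⟩
  calc ∫⁻ z in Metric.closedBall x r, h z ≤ ∫⁻ z in Metric.closedBall x (q : ℝ), h z :=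
        lintegral_mono_set (Metric.closedBall_subset_closedBall h1.le)
    _ ≤ volume (Metric.closedBall x (q : ℝ)) * maximalFunction h x := by
        rw [mul_comm, ← ENNReal.div_le_iff (volume_closedBall_pos x hq)
          (volume_closedBall_ne_top x _), ENNReal.div_eq_inv_mul]
        exact h3
    _ ≤ volume (Metric.closedBall x (2 * r)) * maximalFunction h x := by
        gcongr
    _ = _ := by
        rw [volume_closedBall_mul x x (by norm_num : (0 : ℝ) ≤ 2) hr.le]
        simp

/-- The weak type (1,1) maximal inequality. -/
theorem mul_volume_lt_maximalFunction_le {d : ℕ} (h : Rd d → ℝ≥0∞) (c : ℝ≥0∞) :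
    c * volume {x | c < maximalFunction h x} ≤ 5 ^ d * ∫⁻ z, h z := by
  -- Vitali's covering lemma needs bounded radii, so they are truncated at `N`; the sets increase
  -- with `N`, and the bound is uniform.
  let E : ℕ → Set (Rd d) := fun N => {x | ∃ q : ℚ, 0 < q ∧ q ≤ N ∧
    c < (volume (Metric.closedBall x (q : ℝ)))⁻¹ * ∫⁻ z in Metric.closedBall x (q : ℝ), h z}
  have hE : {x | c < maximalFunction h x} = ⋃ N, E N := by
    ext x
    simp only [maximalFunction, mem_ofPred_eq, lt_iSup_iff, Subtype.exists, mem_iUnion, E]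
    constructor
    · rintro ⟨q, hq, hc⟩
      obtain ⟨N, hN⟩ := exists_nat_ge q
      exact ⟨N, q, hq, hN, hc⟩
    · rintro ⟨N, q, hq, -, hc⟩
      exact ⟨q, hq, hc⟩
  have hmono : Monotone E := by
    rintro m n hmn x ⟨q, hq, hN, hc⟩
    exact ⟨q, hq, hN.trans (by exact_mod_cast hmn), hc⟩
  rw [hE, hmono.measure_iUnion, ENNReal.mul_iSup]
  refine iSup_le fun N => ?_
  let S : Set (Rd d × ℚ) := {a | 0 < a.2 ∧ a.2 ≤ N ∧
    c < (volume (Metric.closedBall a.1 (a.2 : ℝ)))⁻¹ *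
      ∫⁻ z in Metric.closedBall a.1 (a.2 : ℝ), h z}
  obtain ⟨u, huS, hdisj, hcov⟩ := Vitali.exists_disjoint_subfamily_covering_enlargement_closedBall
    S (fun a => a.1) (fun a => (a.2 : ℝ)) N (fun a ha => by exact_mod_cast ha.2.1) 5 (by norm_num)
  have hu : u.Countable := by
    refine hdisj.countable_of_nonempty_interior fun a ha => ?_
    have : (0 : ℝ) < a.2 := by exact_mod_cast (huS ha).1
    exact ⟨a.1, Metric.ball_subset_interior_closedBall (Metric.mem_ball_self this)⟩
  have hsub : E N ⊆ ⋃ b ∈ u, Metric.closedBall b.1 (5 * (b.2 : ℝ)) := by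
    rintro x ⟨q, hq, hN, hc⟩
    obtain ⟨b, hb, hxb⟩ := hcov (x, q) ⟨hq, hN, hc⟩
    refine mem_biUnion hb (hxb (Metric.mem_closedBall_self ?_))
    exact_mod_cast hq.le
  have : Countable u := hu
  calc c * volume (E N) ≤ c * ∑' b : u, volume (Metric.closedBall b.1.1 (5 * (b.1.2 : ℝ))) := by
        gcongr
        exact (measure_mono hsub).trans (measure_biUnion_le _ hu _)
    _ = 5 ^ d * ∑' b : u, c * volume (Metric.closedBall b.1.1 (b.1.2 : ℝ)) := by
        have h5 : ∀ b : u, volume (Metric.closedBall b.1.1 (5 * (b.1.2 : ℝ))) =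
            5 ^ d * volume (Metric.closedBall b.1.1 (b.1.2 : ℝ)) := by
          intro b
          have hq : (0 : ℝ) < b.1.2 := by exact_mod_cast (huS b.2).1
          rw [volume_closedBall_mul _ b.1.1 (by norm_num : (0 : ℝ) ≤ 5) hq.le]
          norm_num
        simp_rw [h5, ENNReal.tsum_mul_left]
        rw [mul_left_comm]
    _ ≤ 5 ^ d * ∑' b : u, ∫⁻ z in Metric.closedBall b.1.1 (b.1.2 : ℝ), h z := by
        gcongr with b
        have hb := huS b.2
        have hq : (0 : ℝ) < b.1.2 := by exact_mod_cast hb.1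
        have := hb.2.2.le
        rwa [← ENNReal.div_eq_inv_mul, ENNReal.le_div_iff_mul_le
          (Or.inl (volume_closedBall_pos _ hq)) (Or.inl (volume_closedBall_ne_top _ _))] at this
    _ = 5 ^ d * ∫⁻ z in ⋃ b ∈ u, Metric.closedBall b.1 (b.2 : ℝ), h z := by
        rw [lintegral_biUnion hu (fun b _ => Metric.isClosed_closedBall.measurableSet) hdisj]
    _ ≤ 5 ^ d * ∫⁻ z, h z := by
        gcongr
        exact Measure.restrict_le_self

/-- The layer-cake formula for a single number, obtained from the one for a Dirac mass. Allowing the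
value `⊤` avoids proving beforehand that the maximal function is finite. -/
theorem ENNReal.rpow_eq_lintegral_indicator (a : ℝ≥0∞) {p : ℝ} (hp : 0 < p) :
    a ^ p = ENNReal.ofReal p * ∫⁻ t in Ioi (0 : ℝ),
      {s : ℝ | ENNReal.ofReal s < a}.indicator (fun s => ENNReal.ofReal (s ^ (p - 1))) t := by
  have key : ∀ r : ℝ, 0 ≤ r → ENNReal.ofReal r ^ p = ENNReal.ofReal p * ∫⁻ t in Ioi (0 : ℝ),
      {s : ℝ | ENNReal.ofReal s < ENNReal.ofReal r}.indicator
        (fun s => ENNReal.ofReal (s ^ (p - 1))) t := by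
    intro r hr
    have := lintegral_rpow_eq_lintegral_meas_lt_mul (Measure.dirac ()) (f := fun _ => r)
      (Eventually.of_forall fun _ => hr) aemeasurable_const hp
    rw [lintegral_dirac, ← ENNReal.ofReal_rpow_of_nonneg hr hp.le] at this
    rw [this]
    congr 1
    refine setLIntegral_congr_fun measurableSet_Ioi fun t ht => ?_
    by_cases h : t < r
    · have h' : ENNReal.ofReal t < ENNReal.ofReal r :=
        (ENNReal.ofReal_lt_ofReal_iff (lt_trans ht h)).2 h
      simp [h, h']
    · have h' : ¬ ENNReal.ofReal t < ENNReal.ofReal r := by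
        rw [not_lt] at h ⊢; exact ENNReal.ofReal_le_ofReal h
      simp [h, h']
  induction a with
  | top =>
    rw [ENNReal.top_rpow_of_pos hp]
    symm
    refine ENNReal.eq_top_of_forall_nnreal_le fun r => ?_
    -- The right side is monotone in `a`, so at `⊤` it dominates its value at `r ^ p⁻¹`, which is
    -- the arbitrary number `r`.
    have h1 := key ((r : ℝ) ^ p⁻¹) (by positivity)
    have h2 : ENNReal.ofReal ((r : ℝ) ^ p⁻¹) ^ p = r := by
      rw [ENNReal.ofReal_rpow_of_nonneg (by positivity) hp.le, ← Real.rpow_mul (NNReal.coe_nonneg r),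
        inv_mul_cancel₀ hp.ne', Real.rpow_one, ENNReal.ofReal_coe_nnreal]
    rw [← h2, h1]
    gcongr
    exact le_top
  | coe r => simpa using key r r.2

/-- The strong type (p,p) maximal inequality. -/
theorem exists_lintegral_maximalFunction_rpow_le (d : ℕ) {p : ℝ} (hp : 1 < p) :
    ∃ C : ℝ≥0, ∀ h : Rd d → ℝ≥0∞, Measurable h →
      ∫⁻ x, maximalFunction h x ^ p ≤ C * ∫⁻ x, h x ^ p := by
  have hp0 : 0 < p := by linarith
  have hp1 : 0 < p - 1 := by linarith
  -- The factor `p` is from the layer-cake formula, `5 ^ d * 2` from the weak bound at level `t /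
  -- 2`, and the last factor from integrating `t ^ (p - 2)` over `t < 2 h`.
  refine ⟨Real.toNNReal p * (5 ^ d * 2) * (2 ^ (p - 1) / Real.toNNReal (p - 1)),
    fun h hh => ?_⟩
  have hM := measurable_maximalFunction_right hh
  have weak : ∀ t : ℝ, 0 < t → volume {x | ENNReal.ofReal t < maximalFunction h x} ≤
      5 ^ d * 2 * (ENNReal.ofReal t)⁻¹ * ∫⁻ x, {y | ENNReal.ofReal t < 2 * h y}.indicator h x := by
    intro t ht
    -- Marcinkiewicz truncation: the discarded part of `h` is at most `t / 2`, hence so is its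
    -- maximal function, and only the large part `k` must exceed the remaining `t / 2`.
    set k : Rd d → ℝ≥0∞ := {y | ENNReal.ofReal t < 2 * h y}.indicator h with hk
    have h1 : ∀ x, h x ≤ k x + ENNReal.ofReal t / 2 := by
      intro x
      by_cases hx : ENNReal.ofReal t < 2 * h x
      · simp [hk, hx]
      · refine le_add_left ?_
        rw [not_lt] at hx
        rwa [ENNReal.le_div_iff_mul_le (by simp) (by simp), mul_comm]
    have h2 : {x | ENNReal.ofReal t < maximalFunction h x} ⊆
        {x | ENNReal.ofReal t / 2 < maximalFunction k x} := by
      intro x hx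
      by_contra hcon
      simp only [mem_ofPred_eq, not_lt] at hx hcon
      refine (lt_irrefl (ENNReal.ofReal t)) (hx.trans_le ?_)
      calc _ ≤ maximalFunction k x + ENNReal.ofReal t / 2 :=
            (maximalFunction_mono h1 x).trans (maximalFunction_add_const_le _ _ _)
        _ ≤ ENNReal.ofReal t / 2 + ENNReal.ofReal t / 2 := by gcongr
        _ = _ := ENNReal.add_halves _
    have h3 := mul_volume_lt_maximalFunction_le k (ENNReal.ofReal t / 2)
    have ht0 : ENNReal.ofReal t / 2 ≠ 0 := by simp [ht]
    have ht1 : ENNReal.ofReal t / 2 ≠ ⊤ := ENNReal.div_ne_top (by simp) (by simp)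
    calc _ ≤ volume {x | ENNReal.ofReal t / 2 < maximalFunction k x} := measure_mono h2
      _ ≤ (5 ^ d * ∫⁻ z, k z) / (ENNReal.ofReal t / 2) := by
          rw [ENNReal.le_div_iff_mul_le (Or.inl ht0) (Or.inl ht1), mul_comm]; exact h3
      _ = _ := by
          rw [ENNReal.div_eq_inv_mul, ENNReal.inv_div (by simp) (by simp), ENNReal.div_eq_inv_mul]
          ring
  have hmeas1 : Measurable fun w : Rd d × ℝ =>
      {s : ℝ | ENNReal.ofReal s < maximalFunction h w.1}.indicator
        (fun s => ENNReal.ofReal (s ^ (p - 1))) w.2 := by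
    have : (fun w : Rd d × ℝ => {s : ℝ | ENNReal.ofReal s < maximalFunction h w.1}.indicator
        (fun s => ENNReal.ofReal (s ^ (p - 1))) w.2) =
        {w : Rd d × ℝ | ENNReal.ofReal w.2 < maximalFunction h w.1}.indicator
          fun w => ENNReal.ofReal (w.2 ^ (p - 1)) := rfl
    rw [this]
    exact Measurable.indicator (by fun_prop) (measurableSet_lt (by fun_prop) (by fun_prop))
  have hmeas2 : Measurable fun w : ℝ × Rd d => ENNReal.ofReal (w.1 ^ (p - 1 - 1)) *
      {y | ENNReal.ofReal w.1 < 2 * h y}.indicator h w.2 := by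
    refine Measurable.mul (by fun_prop) ?_
    have : (fun w : ℝ × Rd d => {y | ENNReal.ofReal w.1 < 2 * h y}.indicator h w.2) =
        {w : ℝ × Rd d | ENNReal.ofReal w.1 < 2 * h w.2}.indicator fun w => h w.2 := rfl
    rw [this]
    exact Measurable.indicator (by fun_prop) (measurableSet_lt (by fun_prop) (by fun_prop))
  have hlayer : ∫⁻ x, maximalFunction h x ^ p = ENNReal.ofReal p * ∫⁻ t in Ioi (0 : ℝ),
      ENNReal.ofReal (t ^ (p - 1)) * volume {x | ENNReal.ofReal t < maximalFunction h x} := by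
    simp_rw [ENNReal.rpow_eq_lintegral_indicator _ hp0]
    rw [lintegral_const_mul _ (Measurable.lintegral_prod_right' hmeas1),
      lintegral_lintegral_swap hmeas1.aemeasurable]
    congr 1
    refine lintegral_congr fun t => ?_
    rw [← lintegral_indicator_const (measurableSet_lt measurable_const hM)]
    rfl
  have hinner : ∀ x, ∫⁻ t in Ioi (0 : ℝ), ENNReal.ofReal (t ^ (p - 1 - 1)) *
      {y | ENNReal.ofReal t < 2 * h y}.indicator h x =
        (2 ^ (p - 1) / ENNReal.ofReal (p - 1)) * h x ^ p := by
    intro x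
    have h1 : ∀ t : ℝ, ENNReal.ofReal (t ^ (p - 1 - 1)) *
        {y | ENNReal.ofReal t < 2 * h y}.indicator h x = h x *
        {s : ℝ | ENNReal.ofReal s < 2 * h x}.indicator
          (fun s => ENNReal.ofReal (s ^ (p - 1 - 1))) t := by
      intro t
      by_cases ht : ENNReal.ofReal t < 2 * h x <;> simp only [Set.indicator, mem_ofPred_eq, ht,
        if_true, if_false, mul_zero]
      exact mul_comm _ _
    simp_rw [h1]
    rw [lintegral_const_mul _ (Measurable.indicator (by fun_prop)
      (measurableSet_lt (by fun_prop) measurable_const))]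
    have h2 := ENNReal.rpow_eq_lintegral_indicator (2 * h x) hp1
    have h3 : ENNReal.ofReal (p - 1) ≠ 0 := by simpa using hp
    rw [mul_comm (ENNReal.ofReal (p - 1))] at h2
    replace h2 := (ENNReal.eq_div_iff h3 ENNReal.ofReal_ne_top).2 ((mul_comm _ _).trans h2.symm)
    rw [h2, ENNReal.mul_rpow_of_nonneg _ _ hp1.le]
    have h4 : h x ^ p = h x * h x ^ (p - 1) := by
      conv_lhs => rw [show p = 1 + (p - 1) by ring]
      rw [ENNReal.rpow_add_of_nonneg _ _ zero_le_one hp1.le, ENNReal.rpow_one]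
    rw [h4, ENNReal.div_eq_inv_mul, ENNReal.div_eq_inv_mul]
    ring
  calc ∫⁻ x, maximalFunction h x ^ p
      ≤ ENNReal.ofReal p * ∫⁻ t in Ioi (0 : ℝ), (5 ^ d * 2) * ∫⁻ x,
        ENNReal.ofReal (t ^ (p - 1 - 1)) * {y | ENNReal.ofReal t < 2 * h y}.indicator h x := by
        rw [hlayer]
        gcongr 1
        refine setLIntegral_mono' measurableSet_Ioi fun t (ht : 0 < t) => ?_
        rw [lintegral_const_mul _ (hh.indicator (measurableSet_lt measurable_const (by fun_prop)))]
        calc _ ≤ ENNReal.ofReal (t ^ (p - 1)) * (5 ^ d * 2 * (ENNReal.ofReal t)⁻¹ *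
              ∫⁻ x, {y | ENNReal.ofReal t < 2 * h y}.indicator h x) := by
              gcongr; exact weak t ht
          _ = (5 ^ d * 2) * ((ENNReal.ofReal (t ^ (p - 1)) * (ENNReal.ofReal t)⁻¹) *
              ∫⁻ x, {y | ENNReal.ofReal t < 2 * h y}.indicator h x) := by ring
          _ ≤ _ := by
              rw [← ENNReal.ofReal_inv_of_pos ht, ← ENNReal.ofReal_mul (by positivity),
                Real.rpow_sub_one ht.ne' (p - 1), div_eq_mul_inv]
    _ = ENNReal.ofReal p * (5 ^ d * 2) *
        ((2 ^ (p - 1) / ENNReal.ofReal (p - 1)) * ∫⁻ x, h x ^ p) := by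
        rw [lintegral_const_mul _ (Measurable.lintegral_prod_right' hmeas2),
          lintegral_lintegral_swap hmeas2.aemeasurable]
        simp_rw [hinner]
        rw [lintegral_const_mul _ (by fun_prop), mul_assoc, mul_assoc, mul_assoc]
    _ = _ := by
        rw [ENNReal.coe_mul, ENNReal.coe_mul, ENNReal.coe_div (by simpa using hp),
          ENNReal.coe_rpow_of_nonneg _ hp1.le]
        simp only [ENNReal.ofReal]
        push_cast
        ring

/-! ### The Lusin–Lipschitz inequality for weakly differentiable maps -/

theorem lintegral_comp_homothety {d : ℕ} (F : Rd d → ℝ≥0∞) (x : Rd d) {s : ℝ}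
    (hs : 0 < s) :
    ∫⁻ z, F (x + s • (z - x)) = (ENNReal.ofReal s ^ d)⁻¹ * ∫⁻ z, F z := by
  rw [lintegral_sub_right_eq_self (fun z => F (x + s • z)) x]
  have e : MeasurableEmbedding fun z : Rd d => s • z :=
    (Homeomorph.smulOfNeZero s hs.ne').measurableEmbedding
  rw [← e.lintegral_map (fun z => F (x + z)), Measure.map_addHaar_smul _ hs.ne',
    lintegral_smul_measure, lintegral_add_left_eq_self, finrank_euclideanSpace_fin,
    abs_of_pos (by positivity), ENNReal.ofReal_inv_of_pos (by positivity),
    ENNReal.ofReal_pow hs.le, smul_eq_mul]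

theorem setLIntegral_closedBall_comp_homothety {d : ℕ} (k : Rd d → ℝ≥0∞) (x : Rd d) {s r : ℝ}
    (hs : 0 < s) :
    ∫⁻ z in Metric.closedBall x r, k (x + s • (z - x)) =
      (ENNReal.ofReal s ^ d)⁻¹ * ∫⁻ z in Metric.closedBall x (s * r), k z := by
  rw [← lintegral_indicator Metric.isClosed_closedBall.measurableSet,
    ← lintegral_indicator Metric.isClosed_closedBall.measurableSet,
    ← lintegral_comp_homothety _ x hs]
  refine lintegral_congr fun z => ?_
  have : z ∈ Metric.closedBall x r ↔ x + s • (z - x) ∈ Metric.closedBall x (s * r) := by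
    rw [mem_closedBall_iff_norm, mem_closedBall_iff_norm, add_sub_cancel_left, norm_smul,
      Real.norm_of_nonneg hs.le, mul_le_mul_iff_right₀ hs]
  by_cases hz : z ∈ Metric.closedBall x r
  · rw [indicator_of_mem hz, indicator_of_mem (this.1 hz)]
  · rw [indicator_of_notMem hz, indicator_of_notMem (mt this.2 hz)]

theorem ContDiff.enorm_sub_le_lintegral_enorm_fderiv {E F : Type*} [NormedAddCommGroup E]
    [NormedSpace ℝ E] [NormedAddCommGroup F] [NormedSpace ℝ F] [CompleteSpace F]
    {g : E → F} (hg : ContDiff ℝ 1 g) (x z : E) :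
    ‖g z - g x‖ₑ ≤ ∫⁻ s in Ioc (0 : ℝ) 1, ‖fderiv ℝ g (x + s • (z - x))‖ₑ * ‖z - x‖ₑ := by
  have hd : ∀ s : ℝ, HasDerivAt (fun s : ℝ => g (x + s • (z - x)))
      (fderiv ℝ g (x + s • (z - x)) (z - x)) s := by
    intro s
    have h1 : HasDerivAt (fun s : ℝ => x + s • (z - x)) (z - x) s := by
      simpa using ((hasDerivAt_id s).smul_const (z - x)).const_add x
    exact ((hg.differentiable one_ne_zero) _).hasFDerivAt.comp_hasDerivAt s h1
  have hc : Continuous fun s : ℝ => fderiv ℝ g (x + s • (z - x)) (z - x) :=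
    ((hg.continuous_fderiv one_ne_zero).comp (by fun_prop)).clm_apply continuous_const
  have h := intervalIntegral.integral_eq_sub_of_hasDerivAt (a := 0) (b := 1)
    (fun s _ => hd s) (hc.intervalIntegrable _ _)
  simp only [one_smul, zero_smul, add_zero, add_sub_cancel] at h
  rw [← h, intervalIntegral.integral_of_le zero_le_one]
  refine (enorm_integral_le_lintegral_enorm _).trans (lintegral_mono fun s => ?_)
  exact ContinuousLinearMap.le_opENorm _ _

/-- Integrate the derivative along the segments from `x` and exchange the integrals. At parameter
`s`, the homothety of ratio `s` turns the inner integral into an average of `k` over the ball of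
radius `s r`. -/
theorem ContDiff.setLIntegral_enorm_sub_le {d : ℕ} {g : Rd d → Rd d} (hg : ContDiff ℝ 1 g)
    {k : Rd d → ℝ≥0∞} (hk : Measurable k) (hgk : ∀ x, ‖fderiv ℝ g x‖ₑ ≤ k x) (x : Rd d) {r : ℝ}
    (hr : 0 < r) {a : ℝ≥0∞}
    (ha : ∀ s, 0 < s → ∫⁻ z in Metric.closedBall x s, k z ≤
      volume (Metric.closedBall x s) * a) :
    ∫⁻ z in Metric.closedBall x r, ‖g z - g x‖ₑ ≤
      ENNReal.ofReal r * (volume (Metric.closedBall x r) * a) := by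
  calc ∫⁻ z in Metric.closedBall x r, ‖g z - g x‖ₑ
      ≤ ∫⁻ z in Metric.closedBall x r, ENNReal.ofReal r *
          ∫⁻ s in Ioc (0 : ℝ) 1, k (x + s • (z - x)) := by
        refine setLIntegral_mono' Metric.isClosed_closedBall.measurableSet fun z hz => ?_
        refine (hg.enorm_sub_le_lintegral_enorm_fderiv x z).trans ?_
        rw [← lintegral_const_mul _ (by fun_prop)]
        refine lintegral_mono fun s => ?_
        rw [mul_comm]
        gcongr
        · rw [← ofReal_norm]
          exact ENNReal.ofReal_le_ofReal (mem_closedBall_iff_norm.1 hz)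
        · exact hgk _
    _ = ENNReal.ofReal r * ∫⁻ s in Ioc (0 : ℝ) 1,
          ∫⁻ z in Metric.closedBall x r, k (x + s • (z - x)) := by
        have hm : Measurable fun w : Rd d × ℝ => k (x + w.2 • (w.1 - x)) := by fun_prop
        rw [lintegral_const_mul _ (Measurable.lintegral_prod_right' hm),
          lintegral_lintegral_swap hm.aemeasurable]
    _ ≤ ENNReal.ofReal r * ∫⁻ s in Ioc (0 : ℝ) 1, volume (Metric.closedBall x r) * a := by
        gcongr 1
        refine setLIntegral_mono' measurableSet_Ioc fun s hs => ?_
        rw [setLIntegral_closedBall_comp_homothety k x hs.1]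
        have h1 := ha (s * r) (mul_pos hs.1 hr)
        rw [volume_closedBall_mul x x hs.1.le hr.le, mul_assoc] at h1
        have h2 : ENNReal.ofReal s ^ d ≠ 0 := pow_ne_zero _ (by simpa using hs.1)
        have h3 : ENNReal.ofReal s ^ d ≠ ⊤ := ENNReal.pow_ne_top ENNReal.ofReal_ne_top
        calc _ ≤ (ENNReal.ofReal s ^ d)⁻¹ *
            (ENNReal.ofReal s ^ d * (volume (Metric.closedBall x r) * a)) := by gcongr
          _ = _ := by rw [← mul_assoc, ENNReal.inv_mul_cancel h2 h3, one_mul]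
    _ = _ := by simp

/-- Compare both values with `g z` and average over `z` in the ball of radius `r / 2` about the
midpoint, where `r = ‖x - y‖`. It lies in the balls of radius `r` about `x` and `y`, whose volume is
`2 ^ d` times larger. -/
theorem ContDiff.enorm_sub_le_of_average_fderiv_le {d : ℕ} {g : Rd d → Rd d}
    (hg : ContDiff ℝ 1 g) {k a : Rd d → ℝ≥0∞} (hk : Measurable k)
    (hgk : ∀ x, ‖fderiv ℝ g x‖ₑ ≤ k x)
    (ha : ∀ x s, 0 < s → ∫⁻ z in Metric.closedBall x s, k z ≤
      volume (Metric.closedBall x s) * a x) (x y : Rd d) :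
    ‖g x - g y‖ₑ ≤ 2 ^ d * ‖x - y‖ₑ * (a x + a y) := by
  rcases eq_or_ne x y with rfl | hxy
  · simp
  have hr : 0 < ‖x - y‖ := norm_pos_iff.2 (sub_ne_zero.2 hxy)
  set r := ‖x - y‖ with hr_def
  set m := midpoint ℝ x y with hm
  have hmx : Dist.dist m x = r / 2 := by
    rw [hm, dist_midpoint_left, dist_eq_norm, Real.norm_ofNat]; ring
  have hmy : Dist.dist m y = r / 2 := by
    rw [hm, dist_midpoint_right, dist_eq_norm, Real.norm_ofNat]; ring
  have hBx : Metric.closedBall m (r / 2) ⊆ Metric.closedBall x r :=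
    Metric.closedBall_subset_closedBall' (by rw [hmx]; linarith)
  have hBy : Metric.closedBall m (r / 2) ⊆ Metric.closedBall y r :=
    Metric.closedBall_subset_closedBall' (by rw [hmy]; linarith)
  have hV : ∀ w : Rd d, volume (Metric.closedBall w r) =
      2 ^ d * volume (Metric.closedBall m (r / 2)) := by
    intro w
    have := volume_closedBall_mul w m (by norm_num : (0 : ℝ) ≤ 2) (half_pos hr).le
    rw [mul_div_cancel₀ _ (two_ne_zero)] at this
    simpa using this
  have hc : Continuous g := hg.continuous
  have hpos := volume_closedBall_pos m (half_pos hr)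
  have hfin := volume_closedBall_ne_top m (r / 2)
  have hre : ‖x - y‖ₑ = ENNReal.ofReal r := by rw [hr_def, ofReal_norm]
  have main : ‖g x - g y‖ₑ * volume (Metric.closedBall m (r / 2)) ≤
      (2 ^ d * ‖x - y‖ₑ * (a x + a y)) * volume (Metric.closedBall m (r / 2)) := by
    calc ‖g x - g y‖ₑ * volume (Metric.closedBall m (r / 2))
        = ∫⁻ _ in Metric.closedBall m (r / 2), ‖g x - g y‖ₑ := by rw [setLIntegral_const]
      _ ≤ ∫⁻ z in Metric.closedBall m (r / 2), (‖g z - g x‖ₑ + ‖g z - g y‖ₑ) := by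
          refine lintegral_mono fun z => ?_
          rw [← enorm_neg (g z - g x), neg_sub]
          simpa using enorm_add_le (g x - g z) (g z - g y)
      _ = (∫⁻ z in Metric.closedBall m (r / 2), ‖g z - g x‖ₑ) +
          ∫⁻ z in Metric.closedBall m (r / 2), ‖g z - g y‖ₑ := by
          rw [lintegral_add_left (by fun_prop)]
      _ ≤ ENNReal.ofReal r * (volume (Metric.closedBall x r) * a x) +
          ENNReal.ofReal r * (volume (Metric.closedBall y r) * a y) := by
          gcongr
          · exact (lintegral_mono_set hBx).trans (hg.setLIntegral_enorm_sub_le hk hgk x hr (ha x))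
          · exact (lintegral_mono_set hBy).trans (hg.setLIntegral_enorm_sub_le hk hgk y hr (ha y))
      _ = _ := by rw [hV, hV, hre]; ring
  rwa [ENNReal.mul_le_mul_iff_left hpos hfin] at main

/-- The average over balls of a mollified function is controlled by the mollified maximal
function. -/
theorem setLIntegral_closedBall_mollify_le {d : ℕ} {h ρ : Rd d → ℝ≥0∞} (hh : Measurable h)
    (hρ : Measurable ρ) (x : Rd d) {s : ℝ} (hs : 0 < s) :
    ∫⁻ z in Metric.closedBall x s, ∫⁻ w, ρ w * h (z - w) ≤
      volume (Metric.closedBall x s) * (2 ^ d * ∫⁻ w, ρ w * maximalFunction h (x - w)) := by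
  have hm : Measurable fun q : Rd d × Rd d => ρ q.2 * h (q.1 - q.2) := by fun_prop
  have hM := measurable_maximalFunction_right hh
  rw [lintegral_lintegral_swap hm.aemeasurable, ← lintegral_const_mul _ (by fun_prop),
    ← lintegral_const_mul _ (by fun_prop)]
  refine lintegral_mono fun w => ?_
  rw [lintegral_const_mul _ (by fun_prop)]
  have h1 : ∫⁻ z in Metric.closedBall x s, h (z - w) =
      ∫⁻ z in Metric.closedBall (x - w) s, h z := by
    rw [← lintegral_indicator Metric.isClosed_closedBall.measurableSet,
      ← lintegral_indicator Metric.isClosed_closedBall.measurableSet,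
      ← lintegral_sub_right_eq_self ((Metric.closedBall (x - w) s).indicator _) w]
    refine lintegral_congr fun z => ?_
    simp only [Set.indicator, Metric.mem_closedBall, dist_sub_right]
  rw [h1]
  calc _ ≤ ρ w * (2 ^ d * volume (Metric.closedBall (x - w) s) * maximalFunction h (x - w)) := by
        gcongr; exact setLIntegral_closedBall_le_maximalFunction h _ hs
    _ = _ := by
        rw [Measure.addHaar_closedBall_center volume (x - w), Measure.addHaar_closedBall_center volume x]
        ring

/-- The derivative falls on the mollifier; the weak gradient identity, tested with `z ↦ ρ (x - z)`,
moves it onto `f`. -/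
theorem IsWeakGradient.hasFDerivAt_convolution {d : ℕ} {f : Rd d → Rd d}
    {G : Rd d → Rd d →L[ℝ] Rd d} (hf : IsWeakGradient f G) {ρ : Rd d → ℝ}
    (hρ : ContDiff ℝ ∞ ρ) (hρc : HasCompactSupport ρ) (x : Rd d) :
    ∃ D : Rd d →L[ℝ] Rd d,
      HasFDerivAt (convolution ρ f (ContinuousLinearMap.lsmul ℝ ℝ) volume) D x ∧
      ∀ v, D v = ∫ z, ρ (x - z) • G z v := by
  have h1 : ContDiff ℝ 1 ρ := hρ.of_le (by simp)
  refine ⟨_, hρc.hasFDerivAt_convolution_left _ h1 hf.locallyIntegrable x, fun v => ?_⟩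
  have hint := (hρc.fderiv ℝ).convolutionExists_left
    ((ContinuousLinearMap.lsmul ℝ ℝ : ℝ →L[ℝ] Rd d →L[ℝ] Rd d).precompL (Rd d))
    (h1.continuous_fderiv one_ne_zero) hf.locallyIntegrable x
  rw [convolution_def, ContinuousLinearMap.integral_apply hint]
  have hc : HasCompactSupport fun z => ρ (x - z) :=
    hρc.comp_homeomorph (Homeomorph.subLeft x)
  have hs : ContDiff ℝ ∞ fun z => ρ (x - z) := hρ.comp (contDiff_const.sub contDiff_id)
  rw [hf.integral_eq _ hs hc v, ← integral_neg]
  rw [← integral_sub_left_eq_self _ volume x]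
  refine integral_congr_ae (Eventually.of_forall fun z => ?_)
  have hd : HasFDerivAt (fun z => ρ (x - z)) ((fderiv ℝ ρ (x - z)).comp
      (-(ContinuousLinearMap.id ℝ (Rd d)))) z := by
    have := ((hρ.differentiable (by simp)) (x - z)).hasFDerivAt.comp z
      ((hasFDerivAt_id z).const_sub x)
    exact this
  simp [hd.fderiv, ContinuousLinearMap.precompL_apply]

theorem ContinuousLinearMap.opENorm_le_of_forall {E F : Type*} [NormedAddCommGroup E]
    [NormedSpace ℝ E] [NormedAddCommGroup F] [NormedSpace ℝ F] (D : E →L[ℝ] F) {c : ℝ≥0∞}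
    (h : ∀ v, ‖D v‖ₑ ≤ c * ‖v‖ₑ) : ‖D‖ₑ ≤ c := by
  induction c with
  | top => exact le_top
  | coe c =>
    rw [← ofReal_norm, ← ENNReal.ofReal_coe_nnreal]
    refine ENNReal.ofReal_le_ofReal (D.opNorm_le_bound c.2 fun v => ?_)
    have := h v
    simp only [enorm_eq_nnnorm] at this
    exact_mod_cast this

/-- The bound contains the mollified maximal function of `h`, not the maximal function of the
mollified `h`, because the former converges almost everywhere as the mollifier shrinks. -/
theorem IsWeakGradient.enorm_convolution_sub_le {d : ℕ} {f : Rd d → Rd d}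
    {G : Rd d → Rd d →L[ℝ] Rd d} (hf : IsWeakGradient f G) {h : Rd d → ℝ≥0∞} (hh : Measurable h)
    (hG : ∀ᵐ x, ‖G x‖ₑ = h x) {ρ : Rd d → ℝ} (hρ : ContDiff ℝ ∞ ρ) (hρc : HasCompactSupport ρ)
    (x y : Rd d) :
    ‖convolution ρ f (ContinuousLinearMap.lsmul ℝ ℝ) volume x -
        convolution ρ f (ContinuousLinearMap.lsmul ℝ ℝ) volume y‖ₑ ≤
      2 ^ d * ‖x - y‖ₑ * (2 ^ d * (∫⁻ w, ‖ρ w‖ₑ * maximalFunction h (x - w)) +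
        2 ^ d * ∫⁻ w, ‖ρ w‖ₑ * maximalFunction h (y - w)) := by
  have hρm : Measurable fun w => ‖ρ w‖ₑ := hρ.continuous.measurable.enorm
  have hk : Measurable fun q : Rd d × Rd d => ‖ρ q.2‖ₑ * h (q.1 - q.2) :=
    (hρm.comp measurable_snd).mul (hh.comp (measurable_fst.sub measurable_snd))
  refine ContDiff.enorm_sub_le_of_average_fderiv_le
    (k := fun x => ∫⁻ w, ‖ρ w‖ₑ * h (x - w))
    (a := fun x => 2 ^ d * ∫⁻ w, ‖ρ w‖ₑ * maximalFunction h (x - w))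
    (hρc.contDiff_convolution_left (n := 1) _ (hρ.of_le (by simp)) hf.locallyIntegrable)
    (Measurable.lintegral_prod_right' hk) (fun x => ?_)
    (fun x s hs => setLIntegral_closedBall_mollify_le hh hρm x hs) x y
  obtain ⟨D, hD, hDv⟩ := hf.hasFDerivAt_convolution hρ hρc x
  rw [hD.fderiv]
  refine D.opENorm_le_of_forall fun v => ?_
  rw [hDv]
  have h1 : ∫⁻ w, ‖ρ w‖ₑ * h (x - w) = ∫⁻ z, ‖ρ (x - z)‖ₑ * ‖G z‖ₑ := by
    rw [← lintegral_sub_left_eq_self _ x]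
    refine lintegral_congr_ae ?_
    filter_upwards [hG] with z hz
    simp [hz]
  have h2 : AEMeasurable fun z => ‖ρ (x - z)‖ₑ * ‖G z‖ₑ :=
    AEMeasurable.mul (hρm.comp (measurable_const.sub measurable_id)).aemeasurable
      hf.locallyIntegrable_grad.aestronglyMeasurable.enorm
  rw [h1, ← lintegral_mul_const'' _ h2]
  refine (enorm_integral_le_lintegral_enorm _).trans (lintegral_mono fun z => ?_)
  rw [enorm_smul, mul_assoc]
  gcongr
  exact ContinuousLinearMap.le_opENorm _ _

theorem lintegral_convolution_tendsto {d : ℕ} {m : Rd d → ℝ≥0∞}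
    (hfin : ∀ᵐ x, m x < ⊤) (hloc : LocallyIntegrable (fun x => (m x).toReal))
    {φ : ℕ → ContDiffBump (0 : Rd d)} (hφ : Tendsto (fun i => (φ i).rOut) atTop (𝓝 0))
    {K : ℝ} (hK : ∀ i, (φ i).rOut ≤ K * (φ i).rIn) :
    ∀ᵐ x, Tendsto (fun i => ∫⁻ w, ‖(φ i).normed volume w‖ₑ * m (x - w)) atTop (𝓝 (m x)) := by
  have h1 := ContDiffBump.ae_convolution_tendsto_right_of_locallyIntegrable hφ
    (Eventually.of_forall hK) hloc
  filter_upwards [h1, hfin] with x hx hxfin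
  have h2 := ENNReal.tendsto_ofReal hx
  rw [ENNReal.ofReal_toReal hxfin.ne] at h2
  refine h2.congr fun i => ?_
  have hint := ((φ i).hasCompactSupport_normed (μ := volume)).convolutionExists_left
    (ContinuousLinearMap.lsmul ℝ ℝ) (φ i).continuous_normed hloc x
  rw [convolution_def, ofReal_integral_eq_lintegral_ofReal hint
    (Eventually.of_forall fun w => mul_nonneg ((φ i).nonneg_normed w) ENNReal.toReal_nonneg)]
  have h3 : ∀ᵐ w, m (x - w) < ⊤ :=
    (Measure.measurePreserving_sub_left volume x).quasiMeasurePreserving.ae hfin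
  refine lintegral_congr_ae ?_
  filter_upwards [h3] with w hw
  simp only [ContinuousLinearMap.lsmul_apply, smul_eq_mul]
  rw [ENNReal.ofReal_mul ((φ i).nonneg_normed w), ENNReal.ofReal_toReal hw.ne,
    Real.enorm_of_nonneg ((φ i).nonneg_normed w)]

theorem locallyIntegrable_toReal_of_lintegral_rpow_lt_top {d : ℕ} {m : Rd d → ℝ≥0∞}
    (hm : Measurable m) {p : ℝ} (hp : 1 < p) (hfin : ∫⁻ x, m x ^ p < ⊤) :
    LocallyIntegrable (fun x => (m x).toReal) := by
  have h : MemLp (fun x => (m x).toReal) (ENNReal.ofReal p) volume := by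
    refine ⟨hm.ennreal_toReal.aestronglyMeasurable, ?_⟩
    rw [eLpNorm_lt_top_iff_lintegral_rpow_enorm_lt_top (by simp; linarith) (by simp),
      ENNReal.toReal_ofReal (by linarith)]
    refine lt_of_le_of_lt (lintegral_mono fun x => ?_) hfin
    gcongr
    rw [Real.enorm_of_nonneg ENNReal.toReal_nonneg]
    exact ENNReal.ofReal_toReal_le
  exact h.locallyIntegrable (by simpa using hp.le)

/-- Lusin–Lipschitz inequality for functions with a weak gradient. -/
theorem IsWeakGradient.exists_enorm_sub_le_maximalFunction {d : ℕ} {f : Rd d → Rd d}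
    {G : Rd d → Rd d →L[ℝ] Rd d} (hf : IsWeakGradient f G) {h : Rd d → ℝ≥0∞} (hh : Measurable h)
    (hG : ∀ᵐ x, ‖G x‖ₑ = h x) {p : ℝ} (hp : 1 < p) (hfin : ∫⁻ x, h x ^ p < ⊤) :
    ∃ S : Set (Rd d), (∀ᵐ x, x ∈ S) ∧ ∀ x ∈ S, ∀ y ∈ S,
      ‖f x - f y‖ₑ ≤ 4 ^ d * ‖x - y‖ₑ * (maximalFunction h x + maximalFunction h y) := by
  obtain ⟨C, hC⟩ := exists_lintegral_maximalFunction_rpow_le d hp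
  have hM := measurable_maximalFunction_right hh
  have hMp : ∫⁻ x, maximalFunction h x ^ p < ⊤ :=
    (hC h hh).trans_lt (ENNReal.mul_lt_top ENNReal.coe_lt_top hfin)
  have hMfin : ∀ᵐ x, maximalFunction h x < ⊤ := by
    filter_upwards [ae_lt_top (hM.pow_const p) hMp.ne] with x hx
    by_contra hcon
    rw [not_lt, top_le_iff] at hcon
    rw [hcon, ENNReal.top_rpow_of_pos (by linarith)] at hx
    exact lt_irrefl _ hx
  let φ : ℕ → ContDiffBump (0 : Rd d) := fun n =>
    ⟨1 / (n + 1), 2 * (1 / (n + 1)), by positivity, by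
      have : (0 : ℝ) < 1 / (n + 1) := by positivity
      linarith⟩
  have hφ : Tendsto (fun i => (φ i).rOut) atTop (𝓝 0) := by
    have := (tendsto_one_div_add_atTop_nhds_zero_nat (𝕜 := ℝ)).const_mul 2
    rwa [mul_zero] at this
  have hK : ∀ i, (φ i).rOut ≤ 2 * (φ i).rIn := fun i => le_rfl
  have h1 := lintegral_convolution_tendsto hMfin
    (locallyIntegrable_toReal_of_lintegral_rpow_lt_top hM hp hMp) hφ hK
  have h2 := ContDiffBump.ae_convolution_tendsto_right_of_locallyIntegrable hφ
    (Eventually.of_forall hK) hf.locallyIntegrable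
  -- The good points are those where the mollifications of `f` and of the maximal function both
  -- converge and the latter is finite. The condition concerns one point at a time, so a single null
  -- set serves all pairs.
  refine ⟨_, h1.and (h2.and hMfin), ?_⟩
  rintro x ⟨hx1, hx2, hx3⟩ y ⟨hy1, hy2, hy3⟩
  have hlim1 := (hx2.sub hy2).enorm
  have hfinx : (2 : ℝ≥0∞) ^ d ≠ ⊤ := by simp
  have hlim2 := ENNReal.Tendsto.const_mul
    ((ENNReal.Tendsto.const_mul hx1 (Or.inr hfinx)).add
      (ENNReal.Tendsto.const_mul hy1 (Or.inr hfinx)))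
    (Or.inr (ENNReal.mul_ne_top hfinx (enorm_ne_top (x := x - y))))
  refine (le_of_tendsto_of_tendsto' hlim1 hlim2 fun i =>
    hf.enorm_convolution_sub_le hh hG (φ i).contDiff_normed (φ i).hasCompactSupport_normed
      x y).trans_eq ?_
  -- One `2 ^ d` stems from the midpoint ball, the other from the restriction to rational radii.
  rw [show (4 : ℝ≥0∞) = 2 * 2 by norm_num, mul_pow]
  ring

/-! ### Almost everywhere statements on products; absolutely continuous curves -/

theorem MeasureTheory.ae_ae_swap_of_ae_prod {α β : Type*} [MeasurableSpace α] [MeasurableSpace β]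
    {μ : Measure α} {ν : Measure β} [SFinite μ] [SFinite ν] {P : α → β → Prop}
    (h : ∀ᵐ z ∂μ.prod ν, P z.1 z.2) : ∀ᵐ y ∂ν, ∀ᵐ x ∂μ, P x y := by
  rw [← Measure.prod_swap] at h
  exact Measure.ae_ae_of_ae_prod (ae_of_ae_map measurable_swap.aemeasurable h)

/-- Slicewise null sets need not assemble to a null set without measurability, so the comparison is
made between measurable representatives. -/
theorem MeasureTheory.ae_prod_le_of_ae_ae {α β : Type*} [MeasurableSpace α] [MeasurableSpace β]
    {μ : Measure α} {ν : Measure β} [SFinite μ] [SFinite ν] {f g : α × β → ℝ≥0∞}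
    (hf : AEMeasurable f (μ.prod ν)) (hg : AEMeasurable g (μ.prod ν))
    (h : ∀ᵐ x ∂μ, ∀ᵐ y ∂ν, f (x, y) ≤ g (x, y)) : ∀ᵐ z ∂μ.prod ν, f z ≤ g z := by
  have key : ∀ᵐ z ∂μ.prod ν, hf.mk f z ≤ hg.mk g z := by
    rw [Measure.ae_prod_iff_ae_ae (measurableSet_le hf.measurable_mk hg.measurable_mk)]
    filter_upwards [h, Measure.ae_ae_of_ae_prod hf.ae_eq_mk,
      Measure.ae_ae_of_ae_prod hg.ae_eq_mk] with x h1 h2 h3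
    filter_upwards [h1, h2, h3] with y h4 h5 h6
    rwa [← h5, ← h6]
  filter_upwards [key, hf.ae_eq_mk, hg.ae_eq_mk] with z h1 h2 h3
  rwa [h2, h3]

theorem AbsolutelyContinuousOnInterval.lipschitz_comp {X Y : Type*} [PseudoMetricSpace X]
    [PseudoMetricSpace Y] {f : ℝ → X} {a b : ℝ} (hf : AbsolutelyContinuousOnInterval f a b)
    {φ : X → Y} {K : ℝ≥0} (hφ : LipschitzWith K φ) :
    AbsolutelyContinuousOnInterval (fun t => φ (f t)) a b := by
  have h := Filter.Tendsto.const_mul (K : ℝ) hf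
  rw [mul_zero] at h
  refine squeeze_zero (fun E => Finset.sum_nonneg fun _ _ => dist_nonneg) (fun E => ?_) h
  rw [Finset.mul_sum]
  exact Finset.sum_le_sum fun i _ => hφ.dist_le_mul _ _

theorem AbsolutelyContinuousOnInterval.enorm_sub_le_lintegral {u : ℝ → ℝ} {t : ℝ} (ht : 0 ≤ t)
    (hu : AbsolutelyContinuousOnInterval u 0 t) {g : ℝ → ℝ≥0∞}
    (h : ∀ᵐ s ∂volume.restrict (Ioo 0 t), ∃ u', HasDerivAt u u' s ∧ ‖u'‖ₑ ≤ g s) :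
    ‖u t - u 0‖ₑ ≤ ∫⁻ s in Ioo 0 t, g s := by
  rw [← hu.integral_deriv_eq_sub, intervalIntegral.integral_of_le ht,
    integral_Ioc_eq_integral_Ioo]
  refine (enorm_integral_le_lintegral_enorm _).trans (lintegral_mono_ae ?_)
  filter_upwards [h] with s ⟨u', h1, h2⟩
  rwa [h1.deriv]

/-- Pairing the curve with its own increment `e` reduces this to the scalar fundamental theorem of
calculus, which gives `‖e‖² ≤ t ‖e‖ M`. -/
theorem AbsolutelyContinuousOnInterval.norm_sub_le_mul {E : Type*} [NormedAddCommGroup E]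
    [InnerProductSpace ℝ E] {f f' : ℝ → E} {T M : ℝ} (hM : 0 ≤ M)
    (hf : AbsolutelyContinuousOnInterval f 0 T)
    (h : ∀ᵐ s ∂volume.restrict (Ioo 0 T), HasDerivAt f (f' s) s ∧ ‖f' s‖ ≤ M) {t : ℝ}
    (ht : t ∈ Icc 0 T) : ‖f t - f 0‖ ≤ t * M := by
  set e := f t - f 0 with he
  have hlip : LipschitzWith ‖innerSL ℝ e‖₊ (innerSL ℝ e) := (innerSL ℝ e).lipschitz
  have hsub : uIcc 0 t ⊆ uIcc 0 T := by
    rw [uIcc_of_le ht.1, uIcc_of_le (ht.1.trans ht.2)]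
    exact Icc_subset_Icc_right ht.2
  have hu := (hf.mono hsub).lipschitz_comp hlip
  have h1 := hu.enorm_sub_le_lintegral ht.1 (g := fun _ => ENNReal.ofReal (‖e‖ * M)) (by
    filter_upwards [ae_restrict_of_ae_restrict_of_subset (Ioo_subset_Ioo_right ht.2) h]
      with s ⟨hs1, hs2⟩
    refine ⟨_, (innerSL ℝ e).hasFDerivAt.comp_hasDerivAt s hs1, ?_⟩
    rw [← ofReal_norm]
    refine ENNReal.ofReal_le_ofReal ?_
    rw [innerSL_apply_apply]
    exact (norm_inner_le_norm _ _).trans (by gcongr))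
  rw [← map_sub, ← he, innerSL_apply_apply, real_inner_self_eq_norm_sq, setLIntegral_const,
    Real.volume_Ioo, sub_zero, Real.enorm_of_nonneg (by positivity),
    ← ENNReal.ofReal_mul (by positivity), ENNReal.ofReal_le_ofReal_iff
      (mul_nonneg (by positivity) ht.1)] at h1
  rcases (norm_nonneg e).eq_or_lt with h0 | h0
  · rw [← h0]; exact mul_nonneg ht.1 hM
  · nlinarith

/-! ### Measurability and compressibility of regular Lagrangian flows -/

section Flow

variable {d : ℕ} {T : ℝ} {b X : ℝ → Rd d → Rd d} {L : ℝ≥0}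

theorem IsCompressibilityConstant.ae_comp (hL : IsCompressibilityConstant T X L) {t : ℝ}
    (ht : t ∈ Icc 0 T) {P : Rd d → Prop} (hP : ∀ᵐ y, P y) : ∀ᵐ x, P (X t x) := by
  refine ae_of_ae_map (hL.2 t ht).1 ?_
  exact (Measure.absolutelyContinuous_of_le_smul (hL.2 t ht).2).ae_le hP

theorem IsCompressibilityConstant.aemeasurable_comp {α : Type*} [MeasurableSpace α]
    (hL : IsCompressibilityConstant T X L) {t : ℝ}
    (ht : t ∈ Icc 0 T) {F : Rd d → α} (hF : AEMeasurable F) :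
    AEMeasurable fun x => F (X t x) :=
  (hF.mono_ac (Measure.absolutelyContinuous_of_le_smul (hL.2 t ht).2)).comp_aemeasurable
    (hL.2 t ht).1

theorem IsCompressibilityConstant.lintegral_comp_le (hL : IsCompressibilityConstant T X L) {t : ℝ}
    (ht : t ∈ Icc 0 T) {F : Rd d → ℝ≥0∞} (hF : AEMeasurable F) :
    ∫⁻ x, F (X t x) ≤ L * ∫⁻ y, F y := by
  rw [← lintegral_map' (hF.mono_ac (Measure.absolutelyContinuous_of_le_smul (hL.2 t ht).2))
    (hL.2 t ht).1, ← smul_eq_mul, ← lintegral_smul_measure]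
  exact lintegral_mono' (hL.2 t ht).2 le_rfl

theorem IsCompressibilityConstant.setLIntegral_comp_le (hL : IsCompressibilityConstant T X L)
    {t : ℝ} (ht : t ∈ Icc 0 T) {F : Rd d → ℝ≥0∞} (hF : AEMeasurable F) {A B : Set (Rd d)}
    (hA : MeasurableSet A) (hB : MeasurableSet B) (hAB : ∀ᵐ x, x ∈ A → X t x ∈ B) :
    ∫⁻ x in A, F (X t x) ≤ L * ∫⁻ y in B, F y := by
  rw [← lintegral_indicator hB]
  refine le_trans ?_ (hL.lintegral_comp_le ht (hF.indicator hB))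
  rw [← lintegral_indicator hA]
  refine lintegral_mono_ae ?_
  filter_upwards [hAB] with x hx
  by_cases h : x ∈ A
  · simp [h, hx h]
  · simp [h]

/-- Only the maps at fixed times are assumed measurable. Joint measurability follows by freezing
time on ever finer grids, since almost every trajectory is continuous. -/
theorem IsRegularLagrangianFlow.aemeasurable_uncurry (hX : IsRegularLagrangianFlow T b X) :
    AEMeasurable (fun z : ℝ × Rd d => X z.1 z.2) (spaceTimeMeasure d T) := by
  obtain ⟨L, hL⟩ := hX.compressible
  have hY : ∀ t, ∃ Y : Rd d → Rd d, Measurable Y ∧ (t ∈ Icc 0 T → ∀ᵐ x, X t x = Y x) := by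
    intro t
    by_cases ht : t ∈ Icc 0 T
    · exact ⟨(hL.2 t ht).1.mk _, (hL.2 t ht).1.measurable_mk, fun _ => (hL.2 t ht).1.ae_eq_mk⟩
    · exact ⟨0, measurable_const, fun h => absurd h ht⟩
  choose Y hYm hYe using hY
  have hfl : ∀ n : ℕ, Measurable fun z : ℝ × Rd d =>
      Y ((⌊((n : ℝ) + 1) * z.1⌋₊ : ℝ) / (n + 1)) z.2 := by
    intro n
    have h1 : Measurable fun w : ℕ × Rd d => Y ((w.1 : ℝ) / (n + 1)) w.2 :=
      by
      refine measurable_from_prod_countable_right fun k => ?_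
      exact hYm ((k : ℝ) / (n + 1))
    have h2 : Measurable fun z : ℝ × Rd d => (⌊((n : ℝ) + 1) * z.1⌋₊, z.2) :=
      (Nat.measurable_floor.comp (by fun_prop)).prodMk measurable_snd
    exact h1.comp h2
  refine aemeasurable_of_tendsto_metrizable_ae atTop (fun n => (hfl n).aemeasurable) ?_
  -- There are countably many grid times, so the representatives agree with the flow at all of them
  -- outside one null set.
  have hall : ∀ᵐ x : Rd d, ∀ n k : ℕ, (k : ℝ) / ((n : ℝ) + 1) ∈ Icc 0 T →
      X ((k : ℝ) / ((n : ℝ) + 1)) x = Y ((k : ℝ) / ((n : ℝ) + 1)) x := by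
    rw [ae_all_iff]; intro n
    rw [ae_all_iff]; intro k
    by_cases h : (k : ℝ) / ((n : ℝ) + 1) ∈ Icc 0 T
    · filter_upwards [hYe _ h] with x hx _ using hx
    · exact Eventually.of_forall fun x hx => absurd hx h
  have h1 : ∀ᵐ z ∂spaceTimeMeasure d T, z.1 ∈ Ioo 0 T :=
    Measure.quasiMeasurePreserving_fst.ae (ae_restrict_mem measurableSet_Ioo)
  have h2 := Measure.quasiMeasurePreserving_snd (μ := volume.restrict (Ioo 0 T))
    (ν := (volume : Measure (Rd d))) |>.ae (hall.and hX.solution)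
  filter_upwards [h1, h2] with z hz1 hz2
  obtain ⟨hz2, -, hac, -⟩ := hz2
  have hcont := hac.continuousOn
  rw [uIcc_of_le (hz1.1.le.trans hz1.2.le)] at hcont
  have hmem : ∀ n : ℕ, (⌊((n : ℝ) + 1) * z.1⌋₊ : ℝ) / (n + 1) ∈ Icc 0 T := by
    intro n
    refine ⟨by positivity, le_trans ?_ hz1.2.le⟩
    rw [div_le_iff₀ (by positivity), mul_comm z.1]
    exact Nat.floor_le (mul_nonneg (by positivity) hz1.1.le)
  have hlim : Tendsto (fun n : ℕ => (⌊((n : ℝ) + 1) * z.1⌋₊ : ℝ) / (n + 1)) atTop (𝓝 z.1) := by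
    have := (tendsto_nat_floor_mul_div_atTop (R := ℝ) hz1.1.le).comp
      (tendsto_atTop_add_const_right atTop (1 : ℝ) tendsto_natCast_atTop_atTop)
    refine this.congr fun n => ?_
    simp [mul_comm]
  have := (hcont z.1 ⟨hz1.1.le, hz1.2.le⟩).tendsto.comp
    (tendsto_nhdsWithin_iff.2 ⟨hlim, Eventually.of_forall hmem⟩)
  exact this.congr fun n => hz2 n _ (hmem n)

theorem IsRegularLagrangianFlow.aemeasurable_graph (hX : IsRegularLagrangianFlow T b X) :
    AEMeasurable (fun z : ℝ × Rd d => (z.1, X z.1 z.2)) (spaceTimeMeasure d T) :=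
  measurable_fst.aemeasurable.prodMk hX.aemeasurable_uncurry

/-- Compressibility holds on every time slice, so space-time null sets pull back to null sets. This
makes compositions such as `b (t, X (t, x))` measurable and insensitive to the choice of
representative. -/
theorem IsRegularLagrangianFlow.map_graph_absolutelyContinuous
    (hX : IsRegularLagrangianFlow T b X) :
    Measure.map (fun z : ℝ × Rd d => (z.1, X z.1 z.2)) (spaceTimeMeasure d T) ≪
      spaceTimeMeasure d T := by
  obtain ⟨L, hL⟩ := hX.compressible
  have hΨ := hX.aemeasurable_graph
  refine Measure.AbsolutelyContinuous.mk fun S hS h0 => ?_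
  rw [Measure.map_congr hΨ.ae_eq_mk, Measure.map_apply hΨ.measurable_mk hS]
  refine (Measure.measure_prod_null (hΨ.measurable_mk hS)).2 ?_
  filter_upwards [Measure.ae_ae_of_ae_prod hΨ.ae_eq_mk, Measure.measure_ae_null_of_prod_null h0,
    ae_restrict_mem measurableSet_Ioo] with t h1 h2 ht
  have h3 : ∀ᵐ y : Rd d, y ∉ Prod.mk t ⁻¹' S := measure_eq_zero_iff_ae_notMem.1 h2
  refine measure_eq_zero_iff_ae_notMem.2 ?_
  filter_upwards [h1, hL.ae_comp ⟨ht.1.le, ht.2.le⟩ h3] with x hx1 hx2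
  simp only [mem_preimage] at hx1 hx2 ⊢
  rwa [← hx1]

theorem IsRegularLagrangianFlow.ae_comp_graph (hX : IsRegularLagrangianFlow T b X)
    {P : ℝ × Rd d → Prop} (hP : ∀ᵐ z ∂spaceTimeMeasure d T, P z) :
    ∀ᵐ z ∂spaceTimeMeasure d T, P (z.1, X z.1 z.2) :=
  ae_of_ae_map hX.aemeasurable_graph (hX.map_graph_absolutelyContinuous.ae_le hP)

theorem IsRegularLagrangianFlow.aestronglyMeasurable_comp_graph {F : Type*} [TopologicalSpace F]
    (hX : IsRegularLagrangianFlow T b X) {f : ℝ × Rd d → F}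
    (hf : AEStronglyMeasurable f (spaceTimeMeasure d T)) :
    AEStronglyMeasurable (fun z : ℝ × Rd d => f (z.1, X z.1 z.2)) (spaceTimeMeasure d T) :=
  (hf.mono_ac hX.map_graph_absolutelyContinuous).comp_aemeasurable hX.aemeasurable_graph

theorem ae_norm_le_supNorm (hb : supNorm T b < ⊤) :
    ∀ᵐ z ∂spaceTimeMeasure d T, ‖b z.1 z.2‖ ≤ (supNorm T b).toReal := by
  have h : ∀ᵐ z ∂spaceTimeMeasure d T, ‖Function.uncurry b z‖ₑ ≤ supNorm T b := by
    rw [supNorm, eLpNorm_exponent_top]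
    exact ae_le_eLpNormEssSup
  filter_upwards [h] with z hz
  rw [← ENNReal.ofReal_le_iff_le_toReal hb.ne, ofReal_norm]
  exact hz

theorem IsRegularLagrangianFlow.ae_norm_sub_le (hX : IsRegularLagrangianFlow T b X)
    (hb : supNorm T b < ⊤) :
    ∀ᵐ x : Rd d, ∀ t ∈ Icc 0 T, ‖X t x - x‖ ≤ t * (supNorm T b).toReal := by
  have h1 := ae_ae_swap_of_ae_prod (P := fun t x => ‖b t (X t x)‖ ≤ (supNorm T b).toReal)
    (hX.ae_comp_graph (ae_norm_le_supNorm hb))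
  filter_upwards [h1, hX.solution] with x hx1 ⟨hx2, hx3, hx4⟩ t ht
  have := hx3.norm_sub_le_mul ENNReal.toReal_nonneg (hx4.and hx1) ht
  rwa [hx2] at this

end Flow

/-! ### The logarithmic gauge -/

section LogDist

variable {E : Type*} [NormedAddCommGroup E]

/-- The smooth logarithmic gauge `½ log (1 + ‖z‖² / δ²)`. -/
noncomputable def logGauge (δ : ℝ) (z : E) : ℝ := Real.log (1 + ‖z‖ ^ 2 / δ ^ 2) / 2

theorem logGauge_nonneg (δ : ℝ) (z : E) : 0 ≤ logGauge δ z :=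
  div_nonneg (Real.log_nonneg (by have : 0 ≤ ‖z‖ ^ 2 / δ ^ 2 := by positivity
                                  linarith)) zero_le_two

theorem logGauge_zero (δ : ℝ) : logGauge δ (0 : E) = 0 := by simp [logGauge]

theorem norm_inv_mul_le {δ : ℝ} (hδ : 0 < δ) (z : E) :
    (δ ^ 2 + ‖z‖ ^ 2)⁻¹ * ‖z‖ ≤ δ⁻¹ := by
  rw [inv_mul_le_iff₀ (by positivity), ← div_eq_mul_inv, le_div_iff₀ hδ]
  nlinarith [sq_nonneg (δ - ‖z‖), norm_nonneg z]

theorem hasFDerivAt_logGauge [InnerProductSpace ℝ E] {δ : ℝ} (hδ : 0 < δ) (z : E) :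
    HasFDerivAt (logGauge δ) ((δ ^ 2 + ‖z‖ ^ 2)⁻¹ • innerSL ℝ z) z := by
  have h1 := (hasStrictFDerivAt_norm_sq z).hasFDerivAt
  have h2 : HasFDerivAt (fun z : E => 1 + ‖z‖ ^ 2 * (δ ^ 2)⁻¹)
      ((δ ^ 2)⁻¹ • (2 • innerSL ℝ z)) z := (h1.mul_const _).const_add _
  have hpos : 0 < 1 + ‖z‖ ^ 2 * (δ ^ 2)⁻¹ := by positivity
  have h3 := (h2.log hpos.ne').mul_const (2 : ℝ)⁻¹
  simp only [← div_eq_mul_inv] at h3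
  refine h3.congr_fderiv ?_
  ext v
  simp only [smul_apply, smul_eq_mul, nsmul_eq_mul, Nat.cast_ofNat]
  field_simp

theorem lipschitzWith_logGauge [InnerProductSpace ℝ E] {δ : ℝ} (hδ : 0 < δ) :
    LipschitzWith (Real.toNNReal δ⁻¹) (logGauge δ : E → ℝ) := by
  refine lipschitzWith_of_nnnorm_fderiv_le (𝕜 := ℝ)
    (fun z => (hasFDerivAt_logGauge hδ z).differentiableAt) fun z => ?_
  rw [(hasFDerivAt_logGauge hδ z).fderiv, ← NNReal.coe_le_coe, coe_nnnorm, norm_smul,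
    innerSL_apply_norm, Real.norm_of_nonneg (by positivity), Real.coe_toNNReal _ (by positivity)]
  exact norm_inv_mul_le hδ z

/-- Split at `‖z‖ = √δ`. Below it, `‖z‖ ≤ √Z δ^{1/4}` absorbs `log δ⁻¹ ≤ 4 δ^{-1/4}`; above it, `1 +
‖z‖² / δ² ≥ δ⁻¹`, so the gauge controls the logarithm. Both terms vanish with `Z`, which later makes
the constant small for small times. -/
theorem mul_abs_log_le_logGauge {δ Z : ℝ} (hδ : 0 < δ) (hδ1 : δ < 1) {z : E} (hz : ‖z‖ ≤ Z) :
    ‖z‖ * |Real.log δ| ≤ 2 * Z * logGauge δ z + 4 * √Z := by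
  have hlog : |Real.log δ| = Real.log δ⁻¹ := by
    rw [abs_of_neg (Real.log_neg hδ hδ1), Real.log_inv]
  have hZ : 0 ≤ Z := (norm_nonneg z).trans hz
  rw [hlog]
  rcases le_total ‖z‖ (√δ) with h | h
  · have h1 : Real.log δ⁻¹ ≤ 4 * √(√δ)⁻¹ := by
      have h2 : Real.log δ⁻¹ = 4 * Real.log √(√δ)⁻¹ := by
        rw [Real.log_sqrt (by positivity), Real.log_inv, Real.log_inv, Real.log_sqrt hδ.le]
        ring
      rw [h2]
      have := Real.log_le_sub_one_of_pos (x := √(√δ)⁻¹) (by positivity)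
      linarith
    have h3 : ‖z‖ ≤ √Z * √(√δ) := by
      rw [← Real.sqrt_mul hZ]
      refine Real.le_sqrt_of_sq_le ?_
      rw [sq]
      gcongr
    have h4 : √(√δ) * √(√δ)⁻¹ = 1 := by
      rw [← Real.sqrt_mul (by positivity), mul_inv_cancel₀ (by positivity), Real.sqrt_one]
    have h5 : 0 ≤ Real.log δ⁻¹ := hlog ▸ abs_nonneg _
    calc ‖z‖ * Real.log δ⁻¹ ≤ (√Z * √(√δ)) * (4 * √(√δ)⁻¹) := by gcongr
      _ = 4 * √Z * (√(√δ) * √(√δ)⁻¹) := by ring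
      _ = 4 * √Z := by rw [h4, mul_one]
      _ ≤ _ := by
        have := logGauge_nonneg δ z
        have : 0 ≤ 2 * Z * logGauge δ z := by positivity
        linarith
  · have h1 : δ⁻¹ ≤ 1 + ‖z‖ ^ 2 / δ ^ 2 := by
      have h2 : δ ≤ ‖z‖ ^ 2 := by
        calc δ = √δ ^ 2 := (Real.sq_sqrt hδ.le).symm
          _ ≤ _ := by gcongr
      have h3 : δ⁻¹ ≤ ‖z‖ ^ 2 / δ ^ 2 := by
        rw [le_div_iff₀ (by positivity)]
        calc δ⁻¹ * δ ^ 2 = δ := by field_simp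
          _ ≤ _ := h2
      linarith
    have h2 : Real.log δ⁻¹ ≤ 2 * logGauge δ z := by
      rw [logGauge, mul_div_cancel₀ _ two_ne_zero]
      exact Real.log_le_log (by positivity) h1
    have h5 : 0 ≤ Real.log δ⁻¹ := hlog ▸ abs_nonneg _
    calc ‖z‖ * Real.log δ⁻¹ ≤ Z * (2 * logGauge δ z) := by gcongr
      _ = 2 * Z * logGauge δ z := by ring
      _ ≤ _ := le_add_of_nonneg_right (by positivity)

end LogDist

/-! ### Minkowski's integral inequality -/

/-- A form of Minkowski's integral inequality. -/
theorem MeasureTheory.lintegral_rpow_le_of_le_lintegral {α β : Type*} [MeasurableSpace α]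
    [MeasurableSpace β] {ν : Measure α} {μ : Measure β} [SFinite ν] [SFinite μ] {U : β → ℝ≥0∞}
    {g : α × β → ℝ≥0∞} {p : ℝ} (hp : 1 < p) (hU : AEMeasurable U μ)
    (hg : AEMeasurable g (ν.prod μ)) (hUg : ∀ᵐ y ∂μ, U y ≤ ∫⁻ s, g (s, y) ∂ν)
    (hfin : ∫⁻ y, U y ^ p ∂μ ≠ ⊤) :
    (∫⁻ y, U y ^ p ∂μ) ^ (1 / p) ≤ ∫⁻ s, (∫⁻ y, g (s, y) ^ p ∂μ) ^ (1 / p) ∂ν := by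
  have hp0 : 0 < p := by linarith
  have hpq := Real.HolderConjugate.conjExponent hp
  set q := p.conjExponent with hq
  set I := ∫⁻ y, U y ^ p ∂μ with hI
  set J := ∫⁻ s, (∫⁻ y, g (s, y) ^ p ∂μ) ^ (1 / p) ∂ν with hJ
  have hpow : ∀ y, U y ^ p = U y * U y ^ (p - 1) := by
    intro y
    conv_lhs => rw [show p = 1 + (p - 1) by ring]
    rw [ENNReal.rpow_add_of_nonneg _ _ zero_le_one (by linarith), ENNReal.rpow_one]
  have hpq' : (p - 1) * q = p := hpq.sub_one_mul_conj
  have hg' : AEMeasurable (fun z : β × α => g (z.2, z.1)) (μ.prod ν) := hg.prod_swap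
  have hprod : AEMeasurable (fun z : β × α => g (z.2, z.1) * U z.1 ^ (p - 1)) (μ.prod ν) :=
    hg'.mul ((hU.comp_quasiMeasurePreserving Measure.quasiMeasurePreserving_fst).pow_const _)
  have hs1 : ∀ᵐ y ∂μ, AEMeasurable (fun s => g (s, y)) ν := by
    filter_upwards [hg'.aestronglyMeasurable.prodMk_left] with y hy using hy.aemeasurable
  have hs2 : ∀ᵐ s ∂ν, AEMeasurable (fun y => g (s, y)) μ := by
    filter_upwards [hg.aestronglyMeasurable.prodMk_left] with y hy using hy.aemeasurable
  -- Write `U ^ p = U * U ^ (p - 1)`, bound the first factor by the integral of `g`, and apply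
  -- Hölder for each `s`. Cancelling `I ^ (1 / q)` afterwards is what requires `hfin`.
  have key : I ≤ J * I ^ (1 / q) := by
    calc I ≤ ∫⁻ y, ∫⁻ s, g (s, y) * U y ^ (p - 1) ∂ν ∂μ := by
          refine lintegral_mono_ae ?_
          filter_upwards [hUg, hs1] with y h1 h2
          rw [hpow, lintegral_mul_const'' _ h2]
          gcongr
      _ = ∫⁻ s, ∫⁻ y, g (s, y) * U y ^ (p - 1) ∂μ ∂ν := lintegral_lintegral_swap hprod
      _ ≤ ∫⁻ s, (∫⁻ y, g (s, y) ^ p ∂μ) ^ (1 / p) * I ^ (1 / q) ∂ν := by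
          refine lintegral_mono_ae ?_
          filter_upwards [hs2] with s h
          refine (ENNReal.lintegral_mul_le_Lp_mul_Lq μ hpq h (hU.pow_const (p - 1))).trans_eq ?_
          simp_rw [← ENNReal.rpow_mul, hpq']
          rw [← hI]
      _ = J * I ^ (1 / q) := by
          rw [lintegral_mul_const'' _ ((AEMeasurable.lintegral_prod_right' (hg.pow_const p)).pow_const _)]
  rcases eq_or_ne I 0 with h0 | h0
  · rw [h0, ENNReal.zero_rpow_of_pos (by positivity)]; exact zero_le
  have hI1 : I ^ (1 / q) ≠ 0 := by
    simp [ENNReal.rpow_eq_zero_iff, h0, hfin]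
  have hI2 : I ^ (1 / q) ≠ ⊤ := ENNReal.rpow_ne_top_of_nonneg (by
    have := hpq.symm.pos
    positivity) hfin
  have hsplit : I = I ^ (1 / p) * I ^ (1 / q) := by
    rw [← ENNReal.rpow_add _ _ h0 hfin, one_div, one_div, hpq.inv_add_inv_eq_one, ENNReal.rpow_one]
  rw [hsplit] at key
  conv at key => rhs; rw [← hsplit]
  rwa [ENNReal.mul_le_mul_iff_left hI1 hI2] at key

/-! ### The differential inequality for the gauge and its `L^p` form -/

section Estimate

variable {d : ℕ} {T p : ℝ}

theorem eLpNorm_ofReal_eq {α F : Type*} [MeasurableSpace α] [NormedAddCommGroup F] (hp : 0 < p)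
    (f : α → F) (μ : Measure α) :
    eLpNorm f (ENNReal.ofReal p) μ = (∫⁻ x, ‖f x‖ₑ ^ p ∂μ) ^ (1 / p) := by
  rw [eLpNorm_eq_lintegral_rpow_enorm_toReal (by simpa using hp) ENNReal.ofReal_ne_top,
    ENNReal.toReal_ofReal hp.le]

theorem aemeasurable_eLpNorm_slice {F : Type*} [NormedAddCommGroup F] (hp : 0 < p)
    {f : ℝ → Rd d → F}
    (hf : AEStronglyMeasurable (Function.uncurry f) (spaceTimeMeasure d T)) (A : Set (Rd d)) :
    AEMeasurable (fun s => eLpNorm (f s) (ENNReal.ofReal p) (volume.restrict A))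
      (volume.restrict (Ioo 0 T)) := by
  simp_rw [eLpNorm_ofReal_eq hp]
  have hac : (volume.restrict (Ioo 0 T)).prod (volume.restrict A) ≪ spaceTimeMeasure d T :=
    Measure.AbsolutelyContinuous.rfl.prod Measure.restrict_le_self.absolutelyContinuous
  exact (AEMeasurable.lintegral_prod_right'
    ((hf.mono_ac hac).enorm.pow_const p)).pow_const _

theorem HasSobolevGradient.ae_lintegral_rpow_lt_top (hp : 0 < p) {b : ℝ → Rd d → Rd d}
    {Db : ℝ → Rd d → Rd d →L[ℝ] Rd d} (hb : HasSobolevGradient T p b Db) :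
    ∀ᵐ s ∂volume.restrict (Ioo 0 T), ∫⁻ y, ‖Db s y‖ₑ ^ p < ⊤ := by
  filter_upwards [ae_lt_top' (aemeasurable_eLpNorm_slice hp hb.measurable_grad univ)
    hb.norm_grad_lt_top.ne] with s hs
  rw [eLpNorm_ofReal_eq hp, Measure.restrict_univ] at hs
  by_contra hcon
  rw [not_lt, top_le_iff] at hcon
  rw [hcon, ENNReal.top_rpow_of_pos (by positivity)] at hs
  exact lt_irrefl _ hs

/-- A jointly measurable representative of the norm of the gradient. -/
theorem HasSobolevGradient.exists_measurable_enorm {b : ℝ → Rd d → Rd d}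
    {Db : ℝ → Rd d → Rd d →L[ℝ] Rd d} (hb : HasSobolevGradient T p b Db) :
    ∃ h : ℝ → Rd d → ℝ≥0∞, Measurable (Function.uncurry h) ∧
      ∀ᵐ s ∂volume.restrict (Ioo 0 T), ∀ᵐ y, ‖Db s y‖ₑ = h s y := by
  refine ⟨fun s y => ‖hb.measurable_grad.mk _ (s, y)‖ₑ,
    hb.measurable_grad.stronglyMeasurable_mk.enorm, ?_⟩
  filter_upwards [Measure.ae_ae_of_ae_prod hb.measurable_grad.ae_eq_mk] with s hs
  filter_upwards [hs] with y hy
  rw [← hy]; rfl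

variable {b b' X X' : ℝ → Rd d → Rd d} {Db Db' : ℝ → Rd d → Rd d →L[ℝ] Rd d}
  {h : ℝ → Rd d → ℝ≥0∞} {L L' : ℝ≥0}

/-- The dominating function in the differential inequality for `logGauge δ (X - X')`. -/
noncomputable def gaugeRate (b b' X X' : ℝ → Rd d → Rd d) (h : ℝ → Rd d → ℝ≥0∞) (δ : ℝ)
    (z : ℝ × Rd d) : ℝ≥0∞ :=
  ENNReal.ofReal δ⁻¹ * ‖b z.1 (X' z.1 z.2) - b' z.1 (X' z.1 z.2)‖ₑ +
    4 ^ d * (maximalFunction (h z.1) (X z.1 z.2) + maximalFunction (h z.1) (X' z.1 z.2))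

theorem IsRegularLagrangianFlow.aemeasurable_maximalFunction
    (hX : IsRegularLagrangianFlow T b X) (hh : Measurable (Function.uncurry h)) :
    AEMeasurable (fun z : ℝ × Rd d => maximalFunction (h z.1) (X z.1 z.2))
      (spaceTimeMeasure d T) :=
  (hX.aestronglyMeasurable_comp_graph
    (measurable_maximalFunction hh).aestronglyMeasurable).aemeasurable

theorem aemeasurable_gaugeRate (hb : HasSobolevGradient T p b Db)
    (hb' : HasSobolevGradient T p b' Db') (hX : IsRegularLagrangianFlow T b X)
    (hX' : IsRegularLagrangianFlow T b' X') (hh : Measurable (Function.uncurry h)) (δ : ℝ) :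
    AEMeasurable (gaugeRate b b' X X' h δ) (spaceTimeMeasure d T) := by
  have h1 := hX'.aestronglyMeasurable_comp_graph (hb.measurable.sub hb'.measurable)
  exact (h1.enorm.const_mul _).add
    (((hX.aemeasurable_maximalFunction hh).add (hX'.aemeasurable_maximalFunction hh)).const_mul _)

theorem HasSobolevGradient.ae_enorm_sub_le (hp : 1 < p) (hb : HasSobolevGradient T p b Db)
    (hX : IsRegularLagrangianFlow T b X) (hX' : IsRegularLagrangianFlow T b' X')
    (hh : Measurable (Function.uncurry h))
    (hDb : ∀ᵐ s ∂volume.restrict (Ioo 0 T), ∀ᵐ y, ‖Db s y‖ₑ = h s y) :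
    ∀ᵐ z ∂spaceTimeMeasure d T, ‖b z.1 (X z.1 z.2) - b z.1 (X' z.1 z.2)‖ₑ ≤
      4 ^ d * ‖X z.1 z.2 - X' z.1 z.2‖ₑ *
        (maximalFunction (h z.1) (X z.1 z.2) + maximalFunction (h z.1) (X' z.1 z.2)) := by
  have hp0 : 0 < p := by linarith
  refine ae_prod_le_of_ae_ae
    ((hX.aestronglyMeasurable_comp_graph hb.measurable).sub
      (hX'.aestronglyMeasurable_comp_graph hb.measurable)).enorm
    (((hX.aemeasurable_uncurry.sub hX'.aemeasurable_uncurry).enorm.const_mul _).mul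
      ((hX.aemeasurable_maximalFunction hh).add (hX'.aemeasurable_maximalFunction hh))) ?_
  obtain ⟨L, hL⟩ := hX.compressible
  obtain ⟨L', hL'⟩ := hX'.compressible
  filter_upwards [hb.isWeakGradient, hDb, hb.ae_lintegral_rpow_lt_top hp0,
    ae_restrict_mem measurableSet_Ioo] with t h1 h2 h3 ht
  have ht' : t ∈ Icc 0 T := ⟨ht.1.le, ht.2.le⟩
  have h4 : ∫⁻ y, h t y ^ p < ⊤ := by
    refine lt_of_eq_of_lt (lintegral_congr_ae ?_) h3
    filter_upwards [h2] with y hy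
    rw [hy]
  obtain ⟨S, hS, hSle⟩ := h1.exists_enorm_sub_le_maximalFunction hh.of_uncurry_left h2 hp h4
  -- The exceptional set depends on `t`; compressibility ensures that both flows avoid it at time
  -- `t` for almost every starting point.
  filter_upwards [hL.ae_comp ht' hS, hL'.ae_comp ht' hS] with x hx hx'
  exact hSle _ hx _ hx'

/-- The factor `‖z‖ / (δ² + ‖z‖²)` is at most `1 / ‖z‖` and at most `1 / δ`. The first bound cancels
the factor `‖z‖` in the Lipschitz part `v`, the second handles the perturbation `w`. -/
theorem enorm_gauge_deriv_le {δ : ℝ} (hδ : 0 < δ) {z v w : Rd d} {c : ℝ≥0∞}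
    (hv : ‖v‖ₑ ≤ ‖z‖ₑ * c) :
    ‖((δ ^ 2 + ‖z‖ ^ 2)⁻¹ • innerSL ℝ z) (v + w)‖ₑ ≤ ENNReal.ofReal δ⁻¹ * ‖w‖ₑ + c := by
  set A := (δ ^ 2 + ‖z‖ ^ 2)⁻¹ * ‖z‖ with hA
  have h0 : ‖((δ ^ 2 + ‖z‖ ^ 2)⁻¹ • innerSL ℝ z) (v + w)‖ₑ ≤ ENNReal.ofReal A * ‖v + w‖ₑ := by
    refine (ContinuousLinearMap.le_opENorm _ _).trans_eq ?_
    rw [← ofReal_norm ((δ ^ 2 + ‖z‖ ^ 2)⁻¹ • innerSL ℝ z), norm_smul, innerSL_apply_norm,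
      Real.norm_of_nonneg (by positivity)]
  have h1 : A ≤ δ⁻¹ := norm_inv_mul_le hδ z
  have h2 : ENNReal.ofReal A * ‖z‖ₑ ≤ 1 := by
    rw [← ofReal_norm, ← ENNReal.ofReal_mul (by positivity), ENNReal.ofReal_le_one, hA, mul_assoc,
      inv_mul_le_one₀ (by positivity)]
    nlinarith [sq_nonneg δ]
  calc _ ≤ ENNReal.ofReal A * ‖v + w‖ₑ := h0
    _ ≤ ENNReal.ofReal A * (‖z‖ₑ * c + ‖w‖ₑ) := by
        gcongr; exact (enorm_add_le _ _).trans (by gcongr)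
    _ = ENNReal.ofReal A * ‖z‖ₑ * c + ENNReal.ofReal A * ‖w‖ₑ := by ring
    _ ≤ 1 * c + ENNReal.ofReal δ⁻¹ * ‖w‖ₑ := by gcongr
    _ = _ := by rw [one_mul, add_comm]

theorem ae_logGauge_le_lintegral (hp : 1 < p) (hb : HasSobolevGradient T p b Db)
    (hX : IsRegularLagrangianFlow T b X) (hX' : IsRegularLagrangianFlow T b' X')
    (hh : Measurable (Function.uncurry h))
    (hDb : ∀ᵐ s ∂volume.restrict (Ioo 0 T), ∀ᵐ y, ‖Db s y‖ₑ = h s y) {δ t : ℝ} (hδ : 0 < δ)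
    (ht : t ∈ Icc 0 T) :
    ∀ᵐ x, ‖logGauge δ (X t x - X' t x)‖ₑ ≤
      ∫⁻ s in Ioo 0 t, gaugeRate b b' X X' h δ (s, x) := by
  have h1 := ae_ae_swap_of_ae_prod (P := fun s x => ‖b s (X s x) - b s (X' s x)‖ₑ ≤
      4 ^ d * ‖X s x - X' s x‖ₑ *
        (maximalFunction (h s) (X s x) + maximalFunction (h s) (X' s x)))
    (hb.ae_enorm_sub_le hp hX hX' hh hDb)
  filter_upwards [h1, hX.solution, hX'.solution] with x hx ⟨hx1, hx2, hx3⟩ ⟨hx1', hx2', hx3'⟩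
  have hsub : uIcc 0 t ⊆ uIcc 0 T := by
    rw [uIcc_of_le ht.1, uIcc_of_le (ht.1.trans ht.2)]
    exact Icc_subset_Icc_right ht.2
  have hu := ((hx2.sub hx2').mono hsub).lipschitz_comp (lipschitzWith_logGauge hδ)
  have key := hu.enorm_sub_le_lintegral ht.1 (g := fun s => gaugeRate b b' X X' h δ (s, x)) (by
    filter_upwards [ae_restrict_of_ae_restrict_of_subset (Ioo_subset_Ioo_right ht.2)
      (hx.and (hx3.and hx3'))] with s ⟨hs1, hs2, hs3⟩
    refine ⟨_, (hasFDerivAt_logGauge hδ _).comp_hasDerivAt s (hs2.sub hs3), ?_⟩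
    -- The two fields are compared along `X'`, so only the speed of `X'` enters the radius of the
    -- larger ball.
    have hsplit : b s (X s x) - b' s (X' s x) =
        (b s (X s x) - b s (X' s x)) + (b s (X' s x) - b' s (X' s x)) := by abel
    rw [hsplit]
    refine enorm_gauge_deriv_le hδ (hs1.trans_eq ?_)
    simp only [Pi.sub_apply]
    ring)
  simpa [hx1, hx1', logGauge_zero] using key

theorem IsCompressibilityConstant.lintegral_rpow_comp_le (hp : 0 < p)
    (hL : IsCompressibilityConstant T X L) {t : ℝ} (ht : t ∈ Icc 0 T) {F : Rd d → ℝ≥0∞}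
    (hF : AEMeasurable F) {A B : Set (Rd d)} (hA : MeasurableSet A) (hB : MeasurableSet B)
    (hAB : ∀ᵐ x, x ∈ A → X t x ∈ B) :
    (∫⁻ x in A, F (X t x) ^ p) ^ (1 / p) ≤
      (L : ℝ≥0∞) ^ (1 / p) * (∫⁻ y in B, F y ^ p) ^ (1 / p) := by
  rw [← ENNReal.mul_rpow_of_nonneg _ _ (by positivity)]
  gcongr
  exact hL.setLIntegral_comp_le ht (hF.pow_const p) hA hB hAB

theorem lintegral_const_mul_rpow {α : Type*} [MeasurableSpace α] {μ : Measure α} (hp : 0 < p)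
    (c : ℝ≥0∞) {F : α → ℝ≥0∞} (hF : AEMeasurable F μ) :
    (∫⁻ x, (c * F x) ^ p ∂μ) ^ (1 / p) = c * (∫⁻ x, F x ^ p ∂μ) ^ (1 / p) := by
  simp_rw [ENNReal.mul_rpow_of_nonneg _ _ hp.le]
  rw [lintegral_const_mul'' _ (hF.pow_const p), ENNReal.mul_rpow_of_nonneg _ _ (by positivity),
    ← ENNReal.rpow_mul, mul_one_div_cancel hp.ne', ENNReal.rpow_one]

theorem lintegral_gaugeRate_rpow_le (hp : 1 < p) {C : ℝ≥0}
    (hC : ∀ h : Rd d → ℝ≥0∞, Measurable h →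
      ∫⁻ x, maximalFunction h x ^ p ≤ C * ∫⁻ x, h x ^ p)
    (hb : HasSobolevGradient T p b Db) (hb' : HasSobolevGradient T p b' Db')
    (hX' : IsRegularLagrangianFlow T b' X') (hM' : supNorm T b' < ⊤)
    (hL : IsCompressibilityConstant T X L) (hL' : IsCompressibilityConstant T X' L')
    (hh : Measurable (Function.uncurry h))
    (hDb : ∀ᵐ s ∂volume.restrict (Ioo 0 T), ∀ᵐ y, ‖Db s y‖ₑ = h s y) (δ r : ℝ) :
    ∀ᵐ s ∂volume.restrict (Ioo 0 T),
      (∫⁻ x in Metric.ball 0 r, gaugeRate b b' X X' h δ (s, x) ^ p) ^ (1 / p) ≤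
        ENNReal.ofReal δ⁻¹ * (L' : ℝ≥0∞) ^ (1 / p) *
          eLpNorm (fun x => b s x - b' s x) (ENNReal.ofReal p)
            (volume.restrict (Metric.ball 0 (r + T * (supNorm T b').toReal))) +
        4 ^ d * ((L : ℝ≥0∞) ^ (1 / p) + (L' : ℝ≥0∞) ^ (1 / p)) * (C : ℝ≥0∞) ^ (1 / p) *
          eLpNorm (Db s) (ENNReal.ofReal p) (volume.restrict univ) := by
  have hp0 : 0 < p := by linarith
  filter_upwards [hDb, ae_restrict_mem measurableSet_Ioo,
    (hb.measurable.sub hb'.measurable).prodMk_left] with s h1 hs h2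
  have hs' : s ∈ Icc 0 T := ⟨hs.1.le, hs.2.le⟩
  have hhs : Measurable (h s) := hh.of_uncurry_left
  have hMs : Measurable (maximalFunction (h s)) := measurable_maximalFunction_right hhs
  set F : Rd d → ℝ≥0∞ := fun y => ‖b s y - b' s y‖ₑ with hF
  have hFm : AEMeasurable F := h2.enorm
  have hball : ∀ᵐ x, x ∈ Metric.ball (0 : Rd d) r →
      X' s x ∈ Metric.ball 0 (r + T * (supNorm T b').toReal) := by
    filter_upwards [hX'.ae_norm_sub_le hM'] with x hx hxr
    rw [mem_ball_zero_iff] at hxr ⊢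
    have h3 := hx s hs'
    have h4 : s * (supNorm T b').toReal ≤ T * (supNorm T b').toReal :=
      mul_le_mul_of_nonneg_right hs.2.le ENNReal.toReal_nonneg
    have h5 := norm_add_le (X' s x - x) x
    rw [sub_add_cancel] at h5
    linarith
  have hmax : ∀ {Y : ℝ → Rd d → Rd d} {K : ℝ≥0}, IsCompressibilityConstant T Y K →
      (∫⁻ x in Metric.ball 0 r, maximalFunction (h s) (Y s x) ^ p) ^ (1 / p) ≤
        (K : ℝ≥0∞) ^ (1 / p) * ((C : ℝ≥0∞) ^ (1 / p) *
          eLpNorm (Db s) (ENNReal.ofReal p) (volume.restrict univ)) := by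
    intro Y K hK
    refine (hK.lintegral_rpow_comp_le hp0 hs' hMs.aemeasurable measurableSet_ball
      MeasurableSet.univ (Eventually.of_forall fun _ _ => mem_univ _)).trans ?_
    gcongr
    rw [eLpNorm_ofReal_eq hp0, Measure.restrict_univ,
      ← ENNReal.mul_rpow_of_nonneg _ _ (by positivity)]
    gcongr
    refine (hC _ hhs).trans_eq ?_
    congr 1
    refine lintegral_congr_ae ?_
    filter_upwards [h1] with y hy
    rw [hy]
  have e1 : AEMeasurable (fun x => F (X' s x)) (volume.restrict (Metric.ball 0 r)) :=
    (hL'.aemeasurable_comp hs' hFm).restrict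
  have e2 : AEMeasurable (fun x => maximalFunction (h s) (X s x))
      (volume.restrict (Metric.ball 0 r)) :=
    (hL.aemeasurable_comp hs' hMs.aemeasurable).restrict
  have e3 : AEMeasurable (fun x => maximalFunction (h s) (X' s x))
      (volume.restrict (Metric.ball 0 r)) :=
    (hL'.aemeasurable_comp hs' hMs.aemeasurable).restrict
  have e4 : AEMeasurable (fun x => maximalFunction (h s) (X s x) + maximalFunction (h s) (X' s x))
      (volume.restrict (Metric.ball 0 r)) := e2.add e3
  calc _ ≤ (∫⁻ x in Metric.ball 0 r, (ENNReal.ofReal δ⁻¹ * F (X' s x)) ^ p) ^ (1 / p) +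
        (∫⁻ x in Metric.ball 0 r, (4 ^ d * (maximalFunction (h s) (X s x) +
          maximalFunction (h s) (X' s x))) ^ p) ^ (1 / p) :=
        ENNReal.lintegral_Lp_add_le (e1.const_mul _) (e4.const_mul _) hp.le
    _ = ENNReal.ofReal δ⁻¹ * (∫⁻ x in Metric.ball 0 r, F (X' s x) ^ p) ^ (1 / p) +
        4 ^ d * (∫⁻ x in Metric.ball 0 r, (maximalFunction (h s) (X s x) +
          maximalFunction (h s) (X' s x)) ^ p) ^ (1 / p) := by
        rw [lintegral_const_mul_rpow hp0 _ e1, lintegral_const_mul_rpow hp0 _ e4]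
    _ ≤ ENNReal.ofReal δ⁻¹ * ((L' : ℝ≥0∞) ^ (1 / p) *
          eLpNorm (fun x => b s x - b' s x) (ENNReal.ofReal p)
            (volume.restrict (Metric.ball 0 (r + T * (supNorm T b').toReal)))) +
        4 ^ d * ((L : ℝ≥0∞) ^ (1 / p) * ((C : ℝ≥0∞) ^ (1 / p) *
          eLpNorm (Db s) (ENNReal.ofReal p) (volume.restrict univ)) +
          (L' : ℝ≥0∞) ^ (1 / p) * ((C : ℝ≥0∞) ^ (1 / p) *
          eLpNorm (Db s) (ENNReal.ofReal p) (volume.restrict univ))) := by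
        gcongr
        · rw [eLpNorm_ofReal_eq hp0]
          exact hL'.lintegral_rpow_comp_le hp0 hs' hFm measurableSet_ball measurableSet_ball hball
        · exact (ENNReal.lintegral_Lp_add_le e2 e3 hp.le).trans (add_le_add (hmax hL) (hmax hL'))
    _ = _ := by ring

theorem ae_norm_flow_sub_le (hX : IsRegularLagrangianFlow T b X)
    (hX' : IsRegularLagrangianFlow T b' X') (hM : supNorm T b < ⊤) (hM' : supNorm T b' < ⊤) :
    ∀ᵐ x, ∀ t ∈ Icc 0 T, ‖X t x - X' t x‖ ≤
      t * ((supNorm T b).toReal + (supNorm T b').toReal) := by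
  filter_upwards [hX.ae_norm_sub_le hM, hX'.ae_norm_sub_le hM'] with x h1 h2 t ht
  have h3 := norm_sub_le (X t x - x) (X' t x - x)
  rw [sub_sub_sub_cancel_right] at h3
  linarith [h1 t ht, h2 t ht]

theorem lintegral_logGauge_rpow_le (hp : 1 < p) {C : ℝ≥0}
    (hC : ∀ h : Rd d → ℝ≥0∞, Measurable h →
      ∫⁻ x, maximalFunction h x ^ p ≤ C * ∫⁻ x, h x ^ p)
    (hb : HasSobolevGradient T p b Db) (hb' : HasSobolevGradient T p b' Db')
    (hM : supNorm T b < ⊤) (hM' : supNorm T b' < ⊤)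
    (hX : IsRegularLagrangianFlow T b X) (hX' : IsRegularLagrangianFlow T b' X')
    (hL : IsCompressibilityConstant T X L) (hL' : IsCompressibilityConstant T X' L')
    {δ t : ℝ} (hδ : 0 < δ) (ht : t ∈ Icc 0 T) (r : ℝ) :
    (∫⁻ x in Metric.ball 0 r, ‖logGauge δ (X t x - X' t x)‖ₑ ^ p) ^ (1 / p) ≤
        ENNReal.ofReal δ⁻¹ * (L' : ℝ≥0∞) ^ (1 / p) *
          mixedNorm t p (Metric.ball 0 (r + T * (supNorm T b').toReal))
            (fun s x => b s x - b' s x) +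
        4 ^ d * ((L : ℝ≥0∞) ^ (1 / p) + (L' : ℝ≥0∞) ^ (1 / p)) * (C : ℝ≥0∞) ^ (1 / p) *
          mixedNorm T p univ Db := by
  have hp0 : 0 < p := by linarith
  obtain ⟨h, hh, hDb⟩ := hb.exists_measurable_enorm
  have hsub : Ioo 0 t ⊆ Ioo 0 T := Ioo_subset_Ioo_right ht.2
  have hac : (volume.restrict (Ioo 0 t)).prod (volume.restrict (Metric.ball (0 : Rd d) r)) ≪
      spaceTimeMeasure d T :=
    (Measure.restrict_mono hsub le_rfl).absolutelyContinuous.prod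
      Measure.restrict_le_self.absolutelyContinuous
  have hlip : Continuous (logGauge δ : Rd d → ℝ) := (lipschitzWith_logGauge hδ).continuous
  have hU : AEMeasurable (fun x => ‖logGauge δ (X t x - X' t x)‖ₑ)
      (volume.restrict (Metric.ball 0 r)) :=
    ((hlip.measurable.comp_aemeasurable ((hL.2 t ht).1.sub (hL'.2 t ht).1)).enorm).restrict
  -- The a priori finiteness needed by Minkowski's inequality: the gauge is `δ⁻¹`-Lipschitz and the
  -- flows stay at bounded distance.
  have hfin : ∫⁻ x in Metric.ball 0 r, ‖logGauge δ (X t x - X' t x)‖ₑ ^ p ≠ ⊤ := by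
    set Z := t * ((supNorm T b).toReal + (supNorm T b').toReal)
    have hle : ∫⁻ x in Metric.ball 0 r, ‖logGauge δ (X t x - X' t x)‖ₑ ^ p ≤
        ∫⁻ x in Metric.ball (0 : Rd d) r, ENNReal.ofReal (δ⁻¹ * Z) ^ p := by
      refine lintegral_mono_ae (ae_restrict_of_ae ?_)
      filter_upwards [ae_norm_flow_sub_le hX hX' hM hM'] with x hx
      gcongr
      rw [← ofReal_norm]
      refine ENNReal.ofReal_le_ofReal ?_
      have h1 := (lipschitzWith_logGauge (E := Rd d) hδ).dist_le_mul (X t x - X' t x) 0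
      rw [logGauge_zero, dist_zero_right, dist_zero_right,
        Real.coe_toNNReal _ (by positivity)] at h1
      exact h1.trans (by gcongr; exact hx t ht)
    refine (hle.trans_lt ?_).ne
    rw [setLIntegral_const]
    exact ENNReal.mul_lt_top (ENNReal.rpow_lt_top_of_nonneg hp0.le ENNReal.ofReal_ne_top)
      measure_ball_lt_top
  have hmink := lintegral_rpow_le_of_le_lintegral hp hU
    ((aemeasurable_gaugeRate hb hb' hX hX' hh δ).mono_ac hac)
    (ae_restrict_of_ae (ae_logGauge_le_lintegral hp hb hX hX' hh hDb hδ ht)) hfin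
  refine hmink.trans ?_
  refine (lintegral_mono_ae (ae_restrict_of_ae_restrict_of_subset hsub
    (lintegral_gaugeRate_rpow_le hp hC hb hb' hX' hM' hL hL' hh hDb δ r))).trans ?_
  have hm1 := aemeasurable_eLpNorm_slice hp0 (f := fun s x => b s x - b' s x)
    (hb.measurable.sub hb'.measurable) (Metric.ball 0 (r + T * (supNorm T b').toReal))
  have hm2 := aemeasurable_eLpNorm_slice hp0 hb.measurable_grad univ
  have hle := (Measure.restrict_mono hsub (le_refl (volume : Measure ℝ)))
  rw [lintegral_add_left' ((hm1.mono_measure hle).const_mul _),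
    lintegral_const_mul'' _ (hm1.mono_measure hle), lintegral_const_mul'' _ (hm2.mono_measure hle)]
  gcongr
  · exact le_rfl
  · exact lintegral_mono_set hsub

end Estimate

/-! ### The constant and the stability estimate -/

/-- The `L^p` norm of the constant `1` on the ball of radius `r` of `ℝ^d`. -/
noncomputable def ballNorm (d : ℕ) (p r : ℝ) : ℝ≥0 :=
  (volume (Metric.ball (0 : Rd d) r)).toNNReal ^ (1 / p)

theorem coe_ballNorm {d : ℕ} {p : ℝ} (hp : 0 < p) (r : ℝ) :
    (ballNorm d p r : ℝ≥0∞) = volume (Metric.ball (0 : Rd d) r) ^ (1 / p) := by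
  rw [ballNorm, ENNReal.coe_rpow_of_nonneg _ (by positivity),
    ENNReal.coe_toNNReal measure_ball_lt_top.ne]

/-- The constant of the stability estimate; `K` is the constant of the maximal inequality. -/
noncomputable def stabilityConstant (d : ℕ) (p T : ℝ) (K : ℝ≥0) (t r : ℝ)
    (M M' L L' D : ℝ≥0) : ℝ≥0 :=
  t.toNNReal +
    2 * (t.toNNReal * (M + M')) *
      (L' ^ (1 / p) + 4 ^ d * (L ^ (1 / p) + L' ^ (1 / p)) * K ^ (1 / p) * D) +
    4 * NNReal.sqrt (t.toNNReal * (M + M')) * ballNorm d p r +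
    t.toNNReal * (M + M') * ballNorm d p r *
      (t.toNNReal * (M + M') * ballNorm d p (r + T * M'))

/-- Every summand carries a factor `t` or `√t`, and the remaining factors are bounded as `t → 0`. -/
theorem tendsto_stabilityConstant (d : ℕ) (p T : ℝ) (K : ℝ≥0) (r : ℝ) (M M' L L' D : ℝ≥0) :
    Tendsto (fun t => stabilityConstant d p T K t r M M' L L' D) (𝓝[>] 0) (𝓝 0) := by
  have hc : Continuous fun t => stabilityConstant d p T K t r M M' L L' D := by
    unfold stabilityConstant
    fun_prop
  refine (hc.tendsto' 0 0 ?_).mono_left nhdsWithin_le_nhds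
  simp [stabilityConstant]

theorem absLogInv_ofReal {δ : ℝ} (hδ : 0 < δ) :
    absLogInv (ENNReal.ofReal δ) = (ENNReal.ofReal |Real.log δ|)⁻¹ := by
  rw [absLogInv, ENNReal.log_ofReal_of_pos hδ, EReal.abs_def]

theorem absLogInv_zero : absLogInv 0 = 0 := by simp [absLogInv]

section Stability

variable {d : ℕ} {T p : ℝ} {b b' X X' : ℝ → Rd d → Rd d} {Db Db' : ℝ → Rd d → Rd d →L[ℝ] Rd d}
  {L L' : ℝ≥0}

/-- Together with `eLpNorm_flow_sub_le`, this linear bound in `t` serves the case where the mixed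
norm is at least `1`. -/
theorem mixedNorm_sub_le (hp : 0 < p) (hM : supNorm T b < ⊤) (hM' : supNorm T b' < ⊤) {t : ℝ}
    (ht : t ≤ T) (R : ℝ) :
    mixedNorm t p (Metric.ball 0 R) (fun s x => b s x - b' s x) ≤
      ENNReal.ofReal t * ENNReal.ofReal ((supNorm T b).toReal + (supNorm T b').toReal) *
        ballNorm d p R := by
  have h1 : ∀ᵐ s ∂volume.restrict (Ioo 0 t), eLpNorm (fun x => b s x - b' s x)
      (ENNReal.ofReal p) (volume.restrict (Metric.ball 0 R)) ≤
        ballNorm d p R * ENNReal.ofReal ((supNorm T b).toReal + (supNorm T b').toReal) := by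
    refine ae_restrict_of_ae_restrict_of_subset (Ioo_subset_Ioo_right ht) ?_
    filter_upwards [Measure.ae_ae_of_ae_prod (ae_norm_le_supNorm hM),
      Measure.ae_ae_of_ae_prod (ae_norm_le_supNorm hM')] with s hs hs'
    have := eLpNorm_le_of_ae_bound (p := ENNReal.ofReal p)
      (μ := volume.restrict (Metric.ball (0 : Rd d) R)) (f := fun x => b s x - b' s x)
      (C := (supNorm T b).toReal + (supNorm T b').toReal) (by
        filter_upwards [ae_restrict_of_ae hs, ae_restrict_of_ae hs'] with x hx hx'
        exact (norm_sub_le _ _).trans (add_le_add hx hx'))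
    rwa [Measure.restrict_apply_univ, ENNReal.toReal_ofReal hp.le, ← one_div,
      ← coe_ballNorm hp] at this
  refine (lintegral_mono_ae h1).trans_eq ?_
  rw [setLIntegral_const, Real.volume_Ioo, sub_zero]
  ring

theorem eLpNorm_flow_sub_le (hp : 0 < p) (hX : IsRegularLagrangianFlow T b X)
    (hX' : IsRegularLagrangianFlow T b' X') (hM : supNorm T b < ⊤) (hM' : supNorm T b' < ⊤)
    {t : ℝ} (ht : t ∈ Icc 0 T) (r : ℝ) :
    eLpNorm (fun x => X t x - X' t x) (ENNReal.ofReal p) (volume.restrict (Metric.ball 0 r)) ≤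
      ENNReal.ofReal (t * ((supNorm T b).toReal + (supNorm T b').toReal)) * ballNorm d p r := by
  have := eLpNorm_le_of_ae_bound (p := ENNReal.ofReal p)
      (μ := volume.restrict (Metric.ball (0 : Rd d) r)) (f := fun x => X t x - X' t x)
      (C := t * ((supNorm T b).toReal + (supNorm T b').toReal)) (by
        filter_upwards [ae_restrict_of_ae (ae_norm_flow_sub_le hX hX' hM hM')] with x hx
        exact hx t ht)
  rwa [Measure.restrict_apply_univ, ENNReal.toReal_ofReal hp.le, ← one_div,
      ← coe_ballNorm hp, mul_comm] at this

/-- Keeping `δ` free above the mixed norm, instead of equal to it, covers the degenerate case in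
which the mixed norm vanishes. -/
theorem eLpNorm_flow_sub_mul_abs_log_le (hp : 1 < p) {K : ℝ≥0}
    (hK : ∀ h : Rd d → ℝ≥0∞, Measurable h →
      ∫⁻ x, maximalFunction h x ^ p ≤ K * ∫⁻ x, h x ^ p)
    (hb : HasSobolevGradient T p b Db) (hb' : HasSobolevGradient T p b' Db')
    (hM : supNorm T b < ⊤) (hM' : supNorm T b' < ⊤)
    (hX : IsRegularLagrangianFlow T b X) (hX' : IsRegularLagrangianFlow T b' X')
    (hL : IsCompressibilityConstant T X L) (hL' : IsCompressibilityConstant T X' L')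
    {δ t : ℝ} (hδ : 0 < δ) (hδ1 : δ < 1) (ht : t ∈ Icc 0 T) (r : ℝ)
    (hε : mixedNorm t p (Metric.ball 0 (r + T * (supNorm T b').toReal))
      (fun s x => b s x - b' s x) ≤ ENNReal.ofReal δ) :
    eLpNorm (fun x => X t x - X' t x) (ENNReal.ofReal p) (volume.restrict (Metric.ball 0 r)) *
        ENNReal.ofReal |Real.log δ| ≤
      stabilityConstant d p T K t r (supNorm T b).toNNReal (supNorm T b').toNNReal L L'
        (mixedNorm T p univ Db).toNNReal := by
  have hp0 : 0 < p := by linarith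
  have hp1 : 0 ≤ 1 / p := by positivity
  set M := (supNorm T b).toNNReal
  set M' := (supNorm T b').toNNReal
  set D := (mixedNorm T p univ Db).toNNReal with hD_def
  have hD : mixedNorm T p univ Db = D := (ENNReal.coe_toNNReal hb.norm_grad_lt_top.ne).symm
  set Z : ℝ := t * ((supNorm T b).toReal + (supNorm T b').toReal) with hZ
  have hZN : Z = ((t.toNNReal * (M + M') : ℝ≥0) : ℝ) := by
    rw [NNReal.coe_mul, Real.coe_toNNReal _ ht.1, NNReal.coe_add]
    rfl
  set B : Measure (Rd d) := volume.restrict (Metric.ball 0 r) with hB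
  set U : Rd d → ℝ≥0∞ := fun x => ‖logGauge δ (X t x - X' t x)‖ₑ with hU
  have hlip : Continuous (logGauge δ : Rd d → ℝ) := (lipschitzWith_logGauge hδ).continuous
  have hdiff : AEMeasurable (fun x => X t x - X' t x) B :=
    ((hL.2 t ht).1.sub (hL'.2 t ht).1).restrict
  have hUm : AEMeasurable U B := (hlip.measurable.comp_aemeasurable hdiff).enorm
  have hlog := lintegral_logGauge_rpow_le hp hK hb hb' hM hM' hX hX' hL hL' hδ ht r
  have hU_le : (∫⁻ x, U x ^ p ∂B) ^ (1 / p) ≤ (L' : ℝ≥0∞) ^ (1 / p) +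
      4 ^ d * ((L : ℝ≥0∞) ^ (1 / p) + (L' : ℝ≥0∞) ^ (1 / p)) * (K : ℝ≥0∞) ^ (1 / p) * D := by
    refine hlog.trans ?_
    rw [hD]
    gcongr
    calc _ ≤ ENNReal.ofReal δ⁻¹ * (L' : ℝ≥0∞) ^ (1 / p) * ENNReal.ofReal δ := by gcongr
      _ = ENNReal.ofReal δ⁻¹ * ENNReal.ofReal δ * (L' : ℝ≥0∞) ^ (1 / p) := by ring
      _ = _ := by
        rw [← ENNReal.ofReal_mul (by positivity), inv_mul_cancel₀ hδ.ne', ENNReal.ofReal_one,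
          one_mul]
  have hconst : (∫⁻ _, ENNReal.ofReal (4 * √Z) ^ p ∂B) ^ (1 / p) =
      ENNReal.ofReal (4 * √Z) * ballNorm d p r := by
    rw [lintegral_const, hB, Measure.restrict_apply_univ, ENNReal.mul_rpow_of_nonneg _ _ hp1,
      ← ENNReal.rpow_mul, mul_one_div_cancel hp0.ne', ENNReal.rpow_one, coe_ballNorm hp0]
  calc eLpNorm (fun x => X t x - X' t x) (ENNReal.ofReal p) B * ENNReal.ofReal |Real.log δ|
      = (∫⁻ x, (ENNReal.ofReal |Real.log δ| * ‖X t x - X' t x‖ₑ) ^ p ∂B) ^ (1 / p) := by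
        rw [lintegral_const_mul_rpow hp0 _ hdiff.enorm, eLpNorm_ofReal_eq hp0, mul_comm]
    _ ≤ (∫⁻ x, (ENNReal.ofReal (2 * Z) * U x + ENNReal.ofReal (4 * √Z)) ^ p ∂B) ^ (1 / p) := by
        refine ENNReal.rpow_le_rpow (lintegral_mono_ae (ae_restrict_of_ae ?_)) hp1
        filter_upwards [ae_norm_flow_sub_le hX hX' hM hM'] with x hx
        have hZ0 : 0 ≤ Z := (norm_nonneg _).trans (hx t ht)
        have h1 := mul_abs_log_le_logGauge hδ hδ1 (hx t ht)
        have h2 := logGauge_nonneg δ (X t x - X' t x)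
        gcongr
        simp only [hU]
        rw [Real.enorm_of_nonneg h2, ← ofReal_norm, ← ENNReal.ofReal_mul (by positivity),
          ← ENNReal.ofReal_mul (by positivity), ← ENNReal.ofReal_add (by positivity)
            (by positivity)]
        exact ENNReal.ofReal_le_ofReal (by rw [mul_comm]; exact h1)
    _ ≤ ENNReal.ofReal (2 * Z) * (∫⁻ x, U x ^ p ∂B) ^ (1 / p) +
        ENNReal.ofReal (4 * √Z) * ballNorm d p r := by
        rw [← hconst, ← lintegral_const_mul_rpow hp0 _ hUm]
        exact ENNReal.lintegral_Lp_add_le (hUm.const_mul _) aemeasurable_const hp.le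
    _ ≤ ENNReal.ofReal (2 * Z) * ((L' : ℝ≥0∞) ^ (1 / p) +
          4 ^ d * ((L : ℝ≥0∞) ^ (1 / p) + (L' : ℝ≥0∞) ^ (1 / p)) * (K : ℝ≥0∞) ^ (1 / p) * D) +
        ENNReal.ofReal (4 * √Z) * ballNorm d p r := by gcongr
    _ = ((2 * (t.toNNReal * (M + M')) *
          (L' ^ (1 / p) + 4 ^ d * (L ^ (1 / p) + L' ^ (1 / p)) * K ^ (1 / p) * D) +
        4 * NNReal.sqrt (t.toNNReal * (M + M')) * ballNorm d p r : ℝ≥0) : ℝ≥0∞) := by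
        rw [hZN, ← Real.coe_sqrt, ENNReal.ofReal_mul zero_le_two,
          ENNReal.ofReal_mul (by norm_num : (0 : ℝ) ≤ 4), ENNReal.ofReal_coe_nnreal,
          ENNReal.ofReal_coe_nnreal]
        push_cast [ENNReal.coe_rpow_of_nonneg _ hp1]
        norm_num
    -- The summands `t` and the one quadratic in `t` are not needed here; they serve `ε = 1` and `ε
    -- ≥ 1`.
    _ ≤ _ := by
        rw [ENNReal.coe_le_coe, stabilityConstant]
        refine le_trans ?_ le_self_add
        gcongr
        exact le_add_self

theorem eLpNorm_flow_sub_le_stabilityConstant (hp : 1 < p) {K : ℝ≥0}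
    (hK : ∀ h : Rd d → ℝ≥0∞, Measurable h →
      ∫⁻ x, maximalFunction h x ^ p ≤ K * ∫⁻ x, h x ^ p)
    (hb : HasSobolevGradient T p b Db) (hb' : HasSobolevGradient T p b' Db')
    (hM : supNorm T b < ⊤) (hM' : supNorm T b' < ⊤)
    (hX : IsRegularLagrangianFlow T b X) (hX' : IsRegularLagrangianFlow T b' X')
    (hL : IsCompressibilityConstant T X L) (hL' : IsCompressibilityConstant T X' L')
    {t : ℝ} (ht : t ∈ Icc 0 T) (r : ℝ) :
    eLpNorm (fun x => X t x - X' t x) (ENNReal.ofReal p) (volume.restrict (Metric.ball 0 r)) ≤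
      (stabilityConstant d p T K t r (supNorm T b).toNNReal (supNorm T b').toNNReal L L'
        (mixedNorm T p univ Db).toNNReal : ℝ≥0∞) *
      absLogInv (mixedNorm t p (Metric.ball 0 (r + T * (supNorm T b').toReal))
        (fun s x => b s x - b' s x)) := by
  have hp0 : 0 < p := by linarith
  have hElin := eLpNorm_flow_sub_le hp0 hX hX' hM hM' ht r
  have hεlin := mixedNorm_sub_le hp0 hM hM' ht.2 (r + T * (supNorm T b').toReal)
  have key := fun {δ : ℝ} (hδ : 0 < δ) (hδ1 : δ < 1) => eLpNorm_flow_sub_mul_abs_log_le hp hK hb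
    hb' hM hM' hX hX' hL hL' hδ hδ1 ht r
  set E := eLpNorm (fun x => X t x - X' t x) (ENNReal.ofReal p)
    (volume.restrict (Metric.ball 0 r)) with hE
  set ε := mixedNorm t p (Metric.ball 0 (r + T * (supNorm T b').toReal))
    (fun s x => b s x - b' s x) with hε
  set C := stabilityConstant d p T K t r (supNorm T b).toNNReal (supNorm T b').toNNReal L L'
    (mixedNorm T p univ Db).toNNReal with hC
  rcases ht.1.eq_or_lt with rfl | ht0
  · have : E = 0 := by simpa using hElin
    rw [this]; exact zero_le
  -- When `ε = 1` the right side is `C * ⊤`, which in `ℝ≥0∞` is infinite only if `C ≠ 0`; the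
  -- summand `t` of the constant guarantees this.
  have hCpos : C ≠ 0 := by
    have h1 : t.toNNReal ≤ C := by
      rw [hC, stabilityConstant, add_assoc, add_assoc]
      exact le_self_add
    exact ((Real.toNNReal_pos.2 ht0).trans_le h1).ne'
  have hεfin : ε ≠ ⊤ := (hεlin.trans_lt (ENNReal.mul_lt_top (ENNReal.mul_lt_top
    ENNReal.ofReal_lt_top ENNReal.ofReal_lt_top) ENNReal.coe_lt_top)).ne
  rcases eq_or_ne ε 0 with h0 | h0
  · rw [h0, absLogInv_zero, mul_zero, nonpos_iff_eq_zero]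
    by_contra hE0
    -- With `ε = 0` every `δ = exp (-n)` is admissible, giving `n * E ≤ C` for all `n ≥ 1`.
    obtain ⟨n, hn⟩ := ENNReal.exists_nat_mul_gt hE0 (ENNReal.coe_ne_top (r := C))
    have hn0 : 0 < (n : ℝ) := by
      rcases Nat.eq_zero_or_pos n with rfl | h
      · simp at hn
      · exact_mod_cast h
    have h1 := key (δ := Real.exp (-n)) (Real.exp_pos _) (Real.exp_lt_one_iff.2 (by linarith))
      (by rw [h0]; exact zero_le)
    rw [Real.log_exp, abs_neg, Nat.abs_cast, ENNReal.ofReal_natCast, mul_comm] at h1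
    exact absurd hn (not_lt.2 h1)
  have hδ : 0 < ε.toReal := ENNReal.toReal_pos h0 hεfin
  have hεδ : ε = ENNReal.ofReal ε.toReal := (ENNReal.ofReal_toReal hεfin).symm
  have hmain : E * ENNReal.ofReal |Real.log ε.toReal| ≤ C := by
    rcases lt_or_ge ε.toReal 1 with h1 | h1
    · exact key hδ h1 hεδ.le
    · have h2 : ENNReal.ofReal |Real.log ε.toReal| ≤ ε := by
        rw [abs_of_nonneg (Real.log_nonneg h1)]
        conv_rhs => rw [hεδ]
        exact ENNReal.ofReal_le_ofReal (Real.log_le_self hδ.le)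
      have hMM : ENNReal.ofReal ((supNorm T b).toReal + (supNorm T b').toReal) =
          (((supNorm T b).toNNReal + (supNorm T b').toNNReal : ℝ≥0) : ℝ≥0∞) := by
        rw [ENNReal.ofReal_add ENNReal.toReal_nonneg ENNReal.toReal_nonneg,
          ENNReal.ofReal_toReal hM.ne, ENNReal.ofReal_toReal hM'.ne, ENNReal.coe_add,
          ENNReal.coe_toNNReal hM.ne, ENNReal.coe_toNNReal hM'.ne]
      rw [ENNReal.ofReal_mul ht.1, hMM] at hElin
      rw [hMM] at hεlin
      calc _ ≤ _ := mul_le_mul' hElin (h2.trans hεlin)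
        _ = ((t.toNNReal * ((supNorm T b).toNNReal + (supNorm T b').toNNReal) * ballNorm d p r *
            (t.toNNReal * ((supNorm T b).toNNReal + (supNorm T b').toNNReal) *
              ballNorm d p (r + T * (supNorm T b').toReal)) : ℝ≥0) : ℝ≥0∞) := by
            push_cast
            rfl
        _ ≤ C := ENNReal.coe_le_coe.2 le_add_self
  rw [hεδ, absLogInv_ofReal hδ, ← div_eq_mul_inv, ENNReal.le_div_iff_mul_le
    (Or.inr (by exact_mod_cast hCpos)) (Or.inl ENNReal.ofReal_ne_top)]
  exact hmain

end Stability

theorem mainTheorem2 (d : ℕ) (p T : ℝ) (hp : 1 < p) (hT : 0 < T) :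
    -- `C t r ‖b‖_∞ ‖b'‖_∞ L L' ‖D_x b‖_{L^1(L^p)}`
    ∃ C : ℝ → ℝ → ℝ≥0 → ℝ≥0 → ℝ≥0 → ℝ≥0 → ℝ≥0 → ℝ≥0,
      (∀ (r : ℝ) (M M' L L' D : ℝ≥0),
        Tendsto (fun t => C t r M M' L L' D) (𝓝[>] 0) (𝓝 0)) ∧
      ∀ (r : ℝ) (b b' X X' : ℝ → Rd d → Rd d) (Db Db' : ℝ → Rd d → Rd d →L[ℝ] Rd d)
        (L L' : ℝ≥0),
        0 < r →
        HasSobolevGradient T p b Db → HasSobolevGradient T p b' Db' →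
        supNorm T b < ⊤ → supNorm T b' < ⊤ →
        IsRegularLagrangianFlow T b X → IsRegularLagrangianFlow T b' X' →
        IsCompressibilityConstant T X L → IsCompressibilityConstant T X' L' →
        ∀ t ∈ Icc 0 T,
          eLpNorm (fun x => X t x - X' t x) (ENNReal.ofReal p)
              (volume.restrict (Metric.ball 0 r)) ≤
            (C t r (supNorm T b).toNNReal (supNorm T b').toNNReal L L'
                (mixedNorm T p univ Db).toNNReal : ℝ≥0∞) *
              absLogInv (mixedNorm t p (Metric.ball 0 (r + T * (supNorm T b').toReal))
                (fun s x => b s x - b' s x)) := by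
  obtain ⟨K, hK⟩ := exists_lintegral_maximalFunction_rpow_le d hp
  refine ⟨stabilityConstant d p T K, tendsto_stabilityConstant d p T K, ?_⟩
  intro r b b' X X' Db Db' L L' _ hb hb' hM hM' hX hX' hL hL' t ht
  exact eLpNorm_flow_sub_le_stabilityConstant hp hK hb hb' hM hM' hX hX' hL hL' ht r
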